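/- Let $\kappa>0$, $f>0$, $r\ge 0$, and let $\|x\|=|x^{(1)}|+|x^{(2)}|$ be the $L_1$ norm on $\mathbb R^2$. A \emph{design} consists of facility locations $x_1,x_2,\dots\in\mathbb R^2$ (listed in the order of the inbound tour) and measurable service regions $\mathcal A_1,\mathcal A_2,\dots\subset\mathbb R^2$ of finite areas $A_i=|\mathcal A_i|$ such that $\mathcal A_i\subseteq\{x:\|x-x_i\|\le\|x-x_j\|\ \forall j\ne i\}$ (ties may be broken arbitrarily), $\bigcup_i\mathcal A_i=\mathbb R^2$, and distinct regions overlap in area zero. For the first $N$ facilities, served by the closed tour $x_1\to x_2\to\dots\to x_N\to x_1$, let $l_i=\frac12\left(\|x_i-x_{i-1}\|+\|x_i-x_{i+1}\|\right)$ (indices modulo $N$) and $$z_N=\frac{f}{\sum_{i=1}^N A_i}\sum_{i=1}^N\left(1+\kappa\int_{\mathcal A_i}\|x-x_i\|\,dx\right)+\frac{\kappa r f}{N}\sum_{i=1}^N l_i\in[0,\infty],$$ where $z_N=\infty$ if $\sum_{i=1}^N A_i=0$. Put $$\alpha^*(r)=\arctan\left(2r+\sqrt{2r+4r^2}\right),\qquad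 \bar g(r)=\frac{3\,(2\cos\alpha^*(r))^{1/2}\,(2\sin\alpha^*(r)+\cos\alpha^*(r))^{3/2}}{3\sin(2\alpha^*(r))-2\cos(2\alpha^*(r))+4}.$$ Then the minimum of $\lim_{N\to\infty}z_N$ over all designs for which this limit exists in $[0,\infty]$ is attained and equals $$z^*=3\sqrt[3]{\frac{\kappa^2f^3}{4\bar g^2(r)}},$$ and every design satisfies $\liminf_{N\to\infty}z_N\ge z^*$. Moreover there is a design with $\lim_{N\to\infty} z_N=z^*$ in which every $\mathcal A_i$ equals the full Voronoi cell $\{x:\|x-x_i\|\le\|x-x_j\|\ \forall j\ne i\}$ and is the translate by $x_i$ of one and the same axis-aligned elongated hexagon, namely the convex hull of the six points $$(\pm R\cos\alpha^*(r),\,\pm R\sin\alpha^*(r)),\qquad (0,\,\pm R(\cos\alpha^*(r)+\sin\alpha^*(r))),$$ with $R>0$ determined by the area $A_i=2R^2(\cos^2\alpha^*(r)+\sin 2\alpha^*(r))=(\kappa/2)^{-2/3}\,\bar g(r)^{2/3}$. If $r>0$, then $0<\alpha^*(r)<\pi/2$ and these six points do not lie on a common circle (for $r=0$ the hexagon degenerates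 to a square with diagonals along the axes). -/

import Mathlib

open MeasureTheory Filter Topology

/-- The `L₁` (rectilinear) distance on the plane. -/
def l1Dist (p q : ℝ × ℝ) : ℝ := |p.1 - q.1| + |p.2 - q.2|

/-- The (closed) `L₁` Voronoi cell of the `i`-th facility. -/
def l1VoronoiCell (x : ℕ → ℝ × ℝ) (i : ℕ) : Set (ℝ × ℝ) :=
  {p | ∀ j, j ≠ i → l1Dist p (x i) ≤ l1Dist p (x j)}

/-- A transshipment design on the plane: infinitely many facilities, listed in the order in which
the inbound truck visits them, together with their service regions. Every customer is served by a
nearest facility (ties may be broken arbitrarily), and the service regions partition the plane up to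
overlaps of area zero. -/
structure FacilityDesign where
  /-- location of the `i`-th facility on the tour -/
  site : ℕ → ℝ × ℝ
  /-- service region of the `i`-th facility -/
  region : ℕ → Set (ℝ × ℝ)
  measurableSet_region : ∀ i, MeasurableSet (region i)
  area_lt_top : ∀ i, volume (region i) < ⊤
  region_subset : ∀ i, region i ⊆ l1VoronoiCell site i
  iUnion_region : ⋃ i, region i = Set.univ
  overlap_null : ∀ i j, i ≠ j → volume (region i ∩ region j) = 0

/-- Half the sum of the distances from facility `i` to its predecessor and to its successor on the
closed tour `0, 1, …, N - 1, 0` through the first `N` facilities. -/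
noncomputable def FacilityDesign.inboundLength (D : FacilityDesign) (N i : ℕ) : ℝ :=
  (l1Dist (D.site i) (D.site ((i + N - 1) % N)) + l1Dist (D.site i) (D.site ((i + 1) % N))) / 2

/-- The outbound travel `∫ ‖p - xᵢ‖₁ dp` over the `i`-th service region. -/
noncomputable def FacilityDesign.outbound (D : FacilityDesign) (i : ℕ) : ENNReal :=
  ∫⁻ p in D.region i, ENNReal.ofReal (l1Dist p (D.site i))

/-- The average system cost of the first `N` facilities: set-up and outbound cost per unit area,
plus `κ r f` times the mean inbound length per facility. It is `⊤` when those `N` regions have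
total area zero or when some outbound travel is infinite. -/
noncomputable def FacilityDesign.avgCost (D : FacilityDesign) (κ f r : ℝ) (N : ℕ) : ENNReal :=
  ENNReal.ofReal f / (∑ i ∈ Finset.range N, volume (D.region i)) *
      (∑ i ∈ Finset.range N, (1 + ENNReal.ofReal κ * D.outbound i)) +
    ENNReal.ofReal (κ * r * f / N * ∑ i ∈ Finset.range N, D.inboundLength N i)

/-- The six vertices `(± R cos α, ± R sin α)` and `(0, ± R (cos α + sin α))`. -/
def hexVertices (R α : ℝ) : Set (ℝ × ℝ) :=
  {(R * Real.cos α, R * Real.sin α), (R * Real.cos α, -(R * Real.sin α)),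
    (-(R * Real.cos α), R * Real.sin α), (-(R * Real.cos α), -(R * Real.sin α)),
    (0, R * Real.cos α + R * Real.sin α), (0, -(R * Real.cos α + R * Real.sin α))}

/-- The elongated hexagon centred at the origin: two sides are parallel to the second axis, the
other four have slope `± 1`. The two triangles crossed by the inbound truck have apex angle `2 α`
at the centre and radial sides of length `R`. For `α = 0` it is a square with diagonals along the
axes. -/
def elongatedHexagon (R α : ℝ) : Set (ℝ × ℝ) := convexHull ℝ (hexVertices R α)

/-- The elongated hexagon is the part of an `L₁` ball in a strip parallel to the second axis. -/
theorem mem_elongatedHexagon_iff {R α : ℝ} (hc : 0 ≤ R * Real.cos α) (hs : 0 ≤ R * Real.sin α)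
    (p : ℝ × ℝ) :
    p ∈ elongatedHexagon R α ↔
      |p.1| ≤ R * Real.cos α ∧ |p.1| + |p.2| ≤ R * Real.cos α + R * Real.sin α := by
  unfold elongatedHexagon hexVertices
  generalize R * Real.cos α = w at *
  generalize R * Real.sin α = s at *
  constructor
  · intro hp
    have hconv : Convex ℝ {q : ℝ × ℝ | |q.1| ≤ w ∧ |q.1| + |q.2| ≤ w + s} := by
      intro a ha b hb u v hu hv huv
      obtain ⟨ha1, ha2⟩ := ha
      obtain ⟨hb1, hb2⟩ := hb
      have h1 : |u * a.1 + v * b.1| ≤ u * |a.1| + v * |b.1| := by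
        refine (abs_add_le _ _).trans ?_
        rw [abs_mul, abs_mul, abs_of_nonneg hu, abs_of_nonneg hv]
      have h2 : |u * a.2 + v * b.2| ≤ u * |a.2| + v * |b.2| := by
        refine (abs_add_le _ _).trans ?_
        rw [abs_mul, abs_mul, abs_of_nonneg hu, abs_of_nonneg hv]
      obtain rfl : v = 1 - u := by linarith
      refine ⟨?_, ?_⟩
      · simp only [Prod.fst_add, Prod.smul_fst, smul_eq_mul]
        nlinarith
      · simp only [Prod.fst_add, Prod.smul_fst, Prod.snd_add, Prod.smul_snd, smul_eq_mul]
        nlinarith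
    refine convexHull_min ?_ hconv hp
    intro q hq
    simp only [Set.mem_insert_iff, Set.mem_singleton_iff] at hq
    rcases hq with rfl | rfl | rfl | rfl | rfl | rfl <;>
      simp [abs_of_nonneg hc, abs_of_nonneg hs] <;>
      first
        | assumption
        | (refine ⟨hc, ?_⟩; rw [abs_le]; constructor <;> linarith)
  · rintro ⟨h1, h2⟩
    obtain ⟨a, b⟩ := p
    simp only at h1 h2
    have key : ∀ e ε : ℝ, (e = 1 ∨ e = -1) → (ε = 1 ∨ ε = -1) → ∀ t, 0 ≤ t → t ≤ w →
        ((e * t, ε * (w + s - t)) : ℝ × ℝ) ∈ convexHull ℝ ({(w, s), (w, -s), (-w, s), (-w, -s),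
          (0, w + s), (0, -(w + s))} : Set (ℝ × ℝ)) := by
      intro e ε he hε t ht0 ht
      have hA : ((e * w, ε * s) : ℝ × ℝ) ∈ convexHull ℝ ({(w, s), (w, -s), (-w, s), (-w, -s),
          (0, w + s), (0, -(w + s))} : Set (ℝ × ℝ)) := by
        apply subset_convexHull
        rcases he with rfl | rfl <;> rcases hε with rfl | rfl <;> simp
      have hB : ((0, ε * (w + s)) : ℝ × ℝ) ∈ convexHull ℝ ({(w, s), (w, -s), (-w, s), (-w, -s),
          (0, w + s), (0, -(w + s))} : Set (ℝ × ℝ)) := by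
        apply subset_convexHull
        rcases hε with rfl | rfl <;> simp
      rcases hc.eq_or_lt with hw | hw
      · have : t = 0 := by linarith
        subst this
        simpa using hB
      · have hm := (convex_convexHull ℝ _) hA hB (a := t / w) (b := 1 - t / w) (by positivity)
          (by rw [sub_nonneg, div_le_one hw]; exact ht) (by ring)
        convert hm using 1
        ext
        · simp
          field_simp
        · simp
          field_simp
          ring
    obtain ⟨e, he, hea⟩ : ∃ e : ℝ, (e = 1 ∨ e = -1) ∧ a = e * |a| := by
      rcases le_total 0 a with h | h
      · exact ⟨1, Or.inl rfl, by rw [abs_of_nonneg h]; ring⟩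
      · exact ⟨-1, Or.inr rfl, by rw [abs_of_nonpos h]; ring⟩
    have ht := key e 1 he (Or.inl rfl) |a| (abs_nonneg a) h1
    have hb := key e (-1) he (Or.inr rfl) |a| (abs_nonneg a) h1
    rw [← hea] at ht hb
    obtain ⟨hb1, hb2⟩ := abs_le.1 (show |b| ≤ w + s - |a| by linarith)
    rcases (show 0 ≤ w + s - |a| by linarith).eq_or_lt with h0 | h0
    · have : b = 0 := by linarith
      subst this
      rw [← h0] at ht
      simpa using ht
    · generalize w + s - |a| = m at *
      have hm := (convex_convexHull ℝ _) ht hb (a := (m + b) / (2 * m)) (b := (m - b) / (2 * m))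
        (div_nonneg (by linarith) (by linarith)) (div_nonneg (by linarith) (by linarith))
        (by field_simp; ring)
      convert hm using 1
      ext
      · simp
        field_simp
        ring
      · simp
        field_simp
        ring

/-- The optimal basic angle `arctan (2 r + √(2 r + 4 r²))`. -/
noncomputable def alphaStar (r : ℝ) : ℝ := Real.arctan (2 * r + √(2 * r + 4 * r ^ 2))

/-- The function `ḡ(r)`. -/
noncomputable def gBar (r : ℝ) : ℝ :=
  3 * (2 * Real.cos (alphaStar r)) ^ (1 / 2 : ℝ) *
      (2 * Real.sin (alphaStar r) + Real.cos (alphaStar r)) ^ (3 / 2 : ℝ) /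
    (3 * Real.sin (2 * alphaStar r) - 2 * Real.cos (2 * alphaStar r) + 4)

/-- The value `3 (κ² f³ / (4 ḡ(r)²))^(1/3)`. -/
noncomputable def optCost (κ f r : ℝ) : ℝ :=
  3 * (κ ^ 2 * f ^ 3 / (4 * gBar r ^ 2)) ^ (1 / 3 : ℝ)

/-! ### Integrals of the rectilinear distance -/

/-! Lower bound. Let `h i` be the cone of height `ρ` over facility `i`, that is `(ρ - ‖p - xᵢ‖)₊`.
Since `ρ ≤ ‖p - xᵢ‖ + h i p`, regions of total area `S` need outbound travel at least `ρ S` minus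
the volume under the upper envelope of the cones. Build the envelope in tour order: if a tour step
has length `2 u`, both of its cones lie above the cone of height `(ρ - u)₊` at the midpoint, so the
new cone adds at most `2/3 (ρ³ - (ρ - u)₊³)` (`lintegral_l1_cone_sub_le`,
`FacilityDesign.mul_sum_area_le`). Thus outbound travel can be saved only by lengthening the tour.

Let `q²` be the mean area and bound the cube below by its tangent at `√r q`. The result is linear in
the tour length, and the slope is such that this term cancels against the inbound cost. The height
`ρ = √(1/2 + r) q` maximises what remains, giving `f / q² + f κ q C` with `C = travelConst r` up to
a term of order `1/N` (`cost_ge`). AM-GM removes `q`, and `gBar r` is `1 / C` (`gBar_eq`).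

Attainment. Equality suggests cells that are `L₁` balls of radius `ρ = w + s` cut by the strip `|x|
≤ w`, with tour steps `2 w` and `s = √r q`. These hexagons tile the plane along a lattice and are
its Voronoi cells. It remains to visit the whole lattice so that every initial segment of the tour,
closed up, has steps of length `2 w` up to a vanishing average error. The tour sweeps parabolic
levels: the first `n` levels hold about `n³` points, while all vertical moves, jumps between levels
and the return trip cost only `O(n²)`. -/

theorem lintegral_Icc_abs {f F : ℝ → ℝ} {m : ℝ} (hm : 0 ≤ m) (hF : ∀ x, HasDerivAt F (f x) x)
    (hf : Continuous f) (h0 : ∀ x, 0 ≤ x → x ≤ m → 0 ≤ f x) :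
    ∫⁻ x in Set.Icc (-m) m, ENNReal.ofReal (f |x|) = ENNReal.ofReal (2 * (F m - F 0)) := by
  have hc : Continuous fun x : ℝ => f |x| := hf.comp continuous_abs
  have hpos : ∫ x in (0 : ℝ)..m, f |x| = F m - F 0 := by
    rw [← intervalIntegral.integral_eq_sub_of_hasDerivAt (fun x _ => hF x)
      (hf.intervalIntegrable _ _)]
    refine intervalIntegral.integral_congr fun x hx => ?_
    rw [Set.uIcc_of_le hm] at hx
    simp [abs_of_nonneg hx.1]
  have hneg : ∫ x in (-m)..0, f |x| = F m - F 0 := by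
    have := intervalIntegral.integral_comp_neg (a := 0) (b := m) (fun x : ℝ => f |x|)
    simp only [abs_neg, neg_zero] at this
    rw [← this, hpos]
  rw [← ofReal_integral_eq_lintegral_ofReal (hc.integrableOn_Icc)]
  · rw [integral_Icc_eq_integral_Ioc, ← intervalIntegral.integral_of_le (by linarith),
      ← intervalIntegral.integral_add_adjacent_intervals (b := 0)
        (hc.intervalIntegrable _ _) (hc.intervalIntegrable _ _), hpos, hneg]
    congr 1
    ring
  · filter_upwards [ae_restrict_mem measurableSet_Icc] with x hx
    exact h0 _ (abs_nonneg _) (abs_le.2 hx)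

theorem lintegral_eq_setLIntegral_Icc_abs {g : ℝ → ENNReal} {m : ℝ}
    (h : ∀ x : ℝ, m < |x| → g x = 0) : ∫⁻ x, g x = ∫⁻ x in Set.Icc (-m) m, g x := by
  rw [← lintegral_indicator measurableSet_Icc]
  refine lintegral_congr fun x => ?_
  by_cases hx : x ∈ Set.Icc (-m) m
  · rw [Set.indicator_of_mem hx]
  · rw [Set.indicator_of_notMem hx, h]
    by_contra! hle
    exact hx (abs_le.1 hle)

theorem lintegral_tent_line (m : ℝ) :
    ∫⁻ y : ℝ, ENNReal.ofReal (m - |y|) = ENNReal.ofReal m ^ 2 := by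
  rcases le_or_gt m 0 with hm | hm
  · rw [ENNReal.ofReal_of_nonpos hm]
    simp only [ne_eq, OfNat.ofNat_ne_zero, not_false_eq_true, zero_pow]
    rw [lintegral_eq_zero_iff (by fun_prop)]
    filter_upwards with y
    exact ENNReal.ofReal_of_nonpos (by have := abs_nonneg y; linarith)
  · rw [lintegral_eq_setLIntegral_Icc_abs (m := m) fun x hx =>
      ENNReal.ofReal_of_nonpos (by linarith),
      lintegral_Icc_abs (f := fun x => m - x) (F := fun x => m * x - x ^ 2 / 2) hm.le
      (fun x => by
        have h := ((hasDerivAt_id x).const_mul m).sub (((hasDerivAt_id x).pow 2).div_const 2)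
        refine h.congr_deriv ?_
        simp) (by fun_prop) (fun x _ h => by linarith), ← ENNReal.ofReal_pow hm.le]
    congr 1
    ring

/-! ### The rectilinear distance and its cones. -/

theorem continuous_l1Dist (c : ℝ × ℝ) : Continuous fun p => l1Dist p c := by
  unfold l1Dist
  fun_prop

theorem l1Dist_nonneg (p q : ℝ × ℝ) : 0 ≤ l1Dist p q := by
  unfold l1Dist
  positivity

theorem l1Dist_comm (p q : ℝ × ℝ) : l1Dist p q = l1Dist q p := by
  unfold l1Dist
  rw [abs_sub_comm, abs_sub_comm p.2]

theorem l1Dist_triangle (p q v : ℝ × ℝ) : l1Dist p v ≤ l1Dist p q + l1Dist q v := by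
  unfold l1Dist
  have h1 := abs_sub_le p.1 q.1 v.1
  have h2 := abs_sub_le p.2 q.2 v.2
  linarith

/-- The volume under an `L₁` cone of height `ρ`. -/
theorem lintegral_l1_cone (ρ : ℝ) (hρ : 0 ≤ ρ) (c : ℝ × ℝ) :
    ∫⁻ p : ℝ × ℝ, ENNReal.ofReal (ρ - l1Dist p c) = ENNReal.ofReal (2 / 3 * ρ ^ 3) := by
  have hshift : ∫⁻ p : ℝ × ℝ, ENNReal.ofReal (ρ - l1Dist p c) =
      ∫⁻ p : ℝ × ℝ, ENNReal.ofReal (ρ - (|p.1| + |p.2|)) :=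
    lintegral_sub_right_eq_self (μ := (volume : Measure (ℝ × ℝ)))
      (fun p : ℝ × ℝ => ENNReal.ofReal (ρ - (|p.1| + |p.2|))) c
  rw [hshift, Measure.volume_eq_prod, lintegral_prod _ (by fun_prop)]
  have hinner : ∀ x : ℝ, ∫⁻ y : ℝ, ENNReal.ofReal (ρ - (|x| + |y|)) =
      ENNReal.ofReal (ρ - |x|) ^ 2 := by
    intro x
    rw [← lintegral_tent_line]
    simp only [sub_sub]
  simp only [hinner]
  rw [lintegral_eq_setLIntegral_Icc_abs (m := ρ) fun x hx => by
    rw [ENNReal.ofReal_of_nonpos (by linarith)]; simp]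
  have hsq : ∫⁻ x in Set.Icc (-ρ) ρ, ENNReal.ofReal (ρ - |x|) ^ 2 =
      ∫⁻ x in Set.Icc (-ρ) ρ, ENNReal.ofReal ((ρ - |x|) ^ 2) := by
    refine setLIntegral_congr_fun measurableSet_Icc fun x hx => ?_
    exact (ENNReal.ofReal_pow (by have := abs_le.2 hx; linarith) 2).symm
  rw [hsq, lintegral_Icc_abs (f := fun x => (ρ - x) ^ 2) (F := fun x => -(ρ - x) ^ 3 / 3) hρ
    (fun x => by
      have h := ((((hasDerivAt_id x).const_sub ρ).pow 3).neg).div_const 3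
      refine h.congr_deriv ?_
      simp) (by fun_prop) (fun x _ _ => by positivity)]
  congr 1
  ring

/-! ### The lower bound for finitely many facilities -/

/-- What an `L₁` cone adds to another one of the same height `ρ` whose apex is at distance
`2 u`. -/
theorem lintegral_l1_cone_sub_le {ρ : ℝ} (hρ : 0 ≤ ρ) (c d : ℝ × ℝ) :
    ∫⁻ p : ℝ × ℝ, (ENNReal.ofReal (ρ - l1Dist p d) - ENNReal.ofReal (ρ - l1Dist p c)) ≤
      ENNReal.ofReal (2 / 3 * (ρ ^ 3 - max (ρ - l1Dist c d / 2) 0 ^ 3)) := by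
  set u := l1Dist c d / 2 with hu
  set m : ℝ × ℝ := ((c.1 + d.1) / 2, (c.2 + d.2) / 2) with hm
  have hmc : l1Dist m c = u := by
    simp only [hm, hu, l1Dist]
    rw [show (c.1 + d.1) / 2 - c.1 = -((c.1 - d.1) / 2) by ring,
      show (c.2 + d.2) / 2 - c.2 = -((c.2 - d.2) / 2) by ring]
    simp only [abs_neg, abs_div, Nat.abs_ofNat]
    ring
  have hmd : l1Dist m d = u := by
    simp only [hm, hu, l1Dist]
    rw [show (c.1 + d.1) / 2 - d.1 = (c.1 - d.1) / 2 by ring,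
      show (c.2 + d.2) / 2 - d.2 = (c.2 - d.2) / 2 by ring]
    simp only [abs_div, Nat.abs_ofNat]
    ring
  set t := max (ρ - u) 0 with ht
  have ht0 : 0 ≤ t := le_max_right _ _
  -- The cone at the midpoint lies below both cones. Subtraction in `ENNReal` truncates, so the
  -- difference is the part of the cone at `d` above the cone at `c`.
  have hpt : ∀ p : ℝ × ℝ,
      (ENNReal.ofReal (ρ - l1Dist p d) - ENNReal.ofReal (ρ - l1Dist p c)) +
        ENNReal.ofReal (t - l1Dist p m) ≤ ENNReal.ofReal (ρ - l1Dist p d) := by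
    intro p
    have h1 : ENNReal.ofReal (t - l1Dist p m) ≤ ENNReal.ofReal (ρ - l1Dist p d) ∧
        ENNReal.ofReal (t - l1Dist p m) ≤ ENNReal.ofReal (ρ - l1Dist p c) := by
      have hc := l1Dist_triangle p m c
      have hd := l1Dist_triangle p m d
      have h0 := l1Dist_nonneg p m
      rcases max_cases (ρ - u) 0 with h | h
      · constructor <;> apply ENNReal.ofReal_le_ofReal <;> linarith
      · rw [ENNReal.ofReal_of_nonpos (p := t - l1Dist p m) (by linarith)]
        simp
    rcases le_total (ENNReal.ofReal (ρ - l1Dist p d)) (ENNReal.ofReal (ρ - l1Dist p c)) with h | h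
    · rw [tsub_eq_zero_of_le h, zero_add]
      exact h1.1
    · calc _ ≤ (ENNReal.ofReal (ρ - l1Dist p d) - ENNReal.ofReal (ρ - l1Dist p c)) +
            ENNReal.ofReal (ρ - l1Dist p c) := add_le_add le_rfl h1.2
        _ = _ := tsub_add_cancel_of_le h
  have hcont : ∀ (s : ℝ) (e : ℝ × ℝ), Measurable fun p => ENNReal.ofReal (s - l1Dist p e) :=
    fun s e => (continuous_const.sub (continuous_l1Dist e)).measurable.ennreal_ofReal
  have hint := lintegral_mono (μ := volume) hpt
  rw [lintegral_add_right _ (hcont _ _), lintegral_l1_cone t ht0, lintegral_l1_cone ρ hρ] at hint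
  rw [mul_sub, ENNReal.ofReal_sub _ (by positivity)]
  exact ENNReal.le_sub_of_add_le_right ENNReal.ofReal_ne_top hint

/-- Facilities of total area `S` have outbound travel at least `ρ S` minus the volume under the
`L₁` cones of height `ρ`, which the inbound tour controls. -/
theorem FacilityDesign.mul_sum_area_le (D : FacilityDesign) {ρ : ℝ} (hρ : 0 ≤ ρ) (n : ℕ) :
    ENNReal.ofReal ρ * ∑ i ∈ Finset.range (n + 1), volume (D.region i) ≤
      ∑ i ∈ Finset.range (n + 1), D.outbound i + (ENNReal.ofReal (2 / 3 * ρ ^ 3) +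
        ∑ i ∈ Finset.range n, ENNReal.ofReal
          (2 / 3 * (ρ ^ 3 - max (ρ - l1Dist (D.site i) (D.site (i + 1)) / 2) 0 ^ 3))) := by
  set h : ℕ → ℝ × ℝ → ENNReal := fun i p => ENNReal.ofReal (ρ - l1Dist p (D.site i)) with hh
  have hmeas : ∀ i, Measurable (h i) := fun i =>
    (continuous_const.sub (continuous_l1Dist _)).measurable.ennreal_ofReal
  have hdiff : ∀ i, Measurable fun p => h (i + 1) p - h i p := fun i => (hmeas _).sub (hmeas _)
  -- A telescoping majorant of all the cones; the differences are truncated, so each summand is what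
  -- one cone adds to its predecessor on the tour.
  set M : ℝ × ℝ → ENNReal := fun p => h 0 p + ∑ i ∈ Finset.range n, (h (i + 1) p - h i p) with hM
  have hMmeas : Measurable M :=
    (hmeas 0).add (Finset.measurable_fun_sum _ fun i _ => hdiff i)
  have hle : ∀ i ≤ n, ∀ p, h i p ≤ M p := by
    intro i hi p
    have : h i p ≤ h 0 p + ∑ j ∈ Finset.range i, (h (j + 1) p - h j p) := by
      clear hi
      induction i with
      | zero => simp
      | succ k ih =>
        rw [Finset.sum_range_succ, ← add_assoc]
        calc h (k + 1) p ≤ h k p + (h (k + 1) p - h k p) := le_add_tsub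
          _ ≤ _ := by gcongr
    refine this.trans ?_
    simp only [hM]
    gcongr
  have hregion : ∀ i ∈ Finset.range (n + 1), ENNReal.ofReal ρ * volume (D.region i) ≤
      D.outbound i + ∫⁻ p in D.region i, M p := by
    intro i hi
    rw [FacilityDesign.outbound, ← lintegral_add_right _ hMmeas, ← setLIntegral_const]
    refine lintegral_mono fun p => ?_
    calc ENNReal.ofReal ρ ≤ ENNReal.ofReal (l1Dist p (D.site i) + (ρ - l1Dist p (D.site i))) := by
          apply ENNReal.ofReal_le_ofReal; linarith
      _ ≤ ENNReal.ofReal (l1Dist p (D.site i)) + h i p := ENNReal.ofReal_add_le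
      _ ≤ _ := by
          gcongr
          exact hle i (by simpa [Nat.lt_succ_iff] using hi) p
  have hsum := Finset.sum_le_sum hregion
  rw [← Finset.mul_sum, Finset.sum_add_distrib] at hsum
  refine hsum.trans ?_
  gcongr
  rw [← lintegral_biUnion_finset₀ (fun i _ j _ hij => D.overlap_null i j hij)
    (fun i _ => (D.measurableSet_region i).nullMeasurableSet)]
  -- The regions are almost disjoint, so their integrals of `M` combine into one integral, which is
  -- enlarged to the whole plane.
  refine (setLIntegral_le_lintegral _ _).trans ?_
  simp only [hM]
  rw [lintegral_add_left (hmeas 0),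
    lintegral_finsetSum _ (fun i _ => hdiff i)]
  refine add_le_add (lintegral_l1_cone ρ hρ _).le (Finset.sum_le_sum fun i _ => ?_)
  exact lintegral_l1_cone_sub_le hρ _ _

theorem FacilityDesign.sum_inboundLength (D : FacilityDesign) (n : ℕ) :
    ∑ i ∈ Finset.range (n + 1), D.inboundLength (n + 1) i =
      ∑ i ∈ Finset.range n, l1Dist (D.site i) (D.site (i + 1)) + l1Dist (D.site n) (D.site 0) := by
  have hnext : ∑ i ∈ Finset.range (n + 1), l1Dist (D.site i) (D.site ((i + 1) % (n + 1))) =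
      ∑ i ∈ Finset.range n, l1Dist (D.site i) (D.site (i + 1)) +
        l1Dist (D.site n) (D.site 0) := by
    rw [Finset.sum_range_succ, Nat.mod_self]
    congr 1
    refine Finset.sum_congr rfl fun i hi => ?_
    rw [Nat.mod_eq_of_lt (by simpa using hi)]
  have hprev : ∑ i ∈ Finset.range (n + 1),
      l1Dist (D.site i) (D.site ((i + (n + 1) - 1) % (n + 1))) =
      ∑ i ∈ Finset.range n, l1Dist (D.site i) (D.site (i + 1)) +
        l1Dist (D.site n) (D.site 0) := by
    -- The index split off here is `0`, whose predecessor is `n`: it carries the closing edge.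
    rw [Finset.sum_range_succ']
    congr 1
    · refine Finset.sum_congr rfl fun i hi => ?_
      rw [show i + 1 + (n + 1) - 1 = i + (n + 1) by omega, Nat.add_mod_right,
        Nat.mod_eq_of_lt (by simp at hi; omega), l1Dist_comm]
    · simp only [zero_add, Nat.add_sub_cancel]
      rw [Nat.mod_eq_of_lt (Nat.lt_succ_self n), l1Dist_comm]
  unfold FacilityDesign.inboundLength
  rw [← Finset.sum_div, Finset.sum_add_distrib, hnext, hprev]
  ring

/-! ### The optimal constants -/

/-- The least travel cost per unit area, for cells of unit area and `κ = 1`. -/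
noncomputable def travelConst (r : ℝ) : ℝ := 4 / 3 * (√(1 / 2 + r) ^ 3 - √r ^ 3)

theorem sqrt_lt_sqrt_half_add {r : ℝ} (hr : 0 ≤ r) : √r < √(1 / 2 + r) :=
  Real.sqrt_lt_sqrt hr (by linarith)

theorem travelConst_pos {r : ℝ} (hr : 0 ≤ r) : 0 < travelConst r := by
  have := pow_lt_pow_left₀ (sqrt_lt_sqrt_half_add hr) (Real.sqrt_nonneg r) (n := 3) (by norm_num)
  unfold travelConst
  linarith

/-- The distance from the centre of the optimal hexagon of unit area to its vertices
`(± R cos α, ± R sin α)`. -/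
noncomputable def unitRadius (r : ℝ) : ℝ :=
  (√(1 / 2 + r) - √r) * √(1 + Real.tan (alphaStar r) ^ 2)

/-- The square root in `alphaStar` is `2 √r √(1/2 + r)`, so the tangent is `2 √r (√r + √(1/2 + r))`;
rationalising gives the ratio `s / w` of the unit-area hexagon. -/
theorem tan_alphaStar {r : ℝ} (hr : 0 ≤ r) :
    Real.tan (alphaStar r) = √r / (√(1 / 2 + r) - √r) := by
  have hlt := sqrt_lt_sqrt_half_add hr
  have h1 : √(2 * r + 4 * r ^ 2) = 2 * (√r * √(1 / 2 + r)) := by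
    rw [← Real.sqrt_mul hr, show 2 * r + 4 * r ^ 2 = 2 ^ 2 * (r * (1 / 2 + r)) by ring,
      Real.sqrt_mul (by positivity), Real.sqrt_sq (by norm_num)]
  rw [alphaStar, Real.tan_arctan, h1, eq_div_iff (by linarith)]
  have h2 := Real.sq_sqrt hr
  have h3 := Real.sq_sqrt (show 0 ≤ 1 / 2 + r by linarith)
  linear_combination (-2 * √r) * h2 + 2 * √r * h3 - 2 * (√(1 / 2 + r) - √r) * h2

theorem unitRadius_pos {r : ℝ} (hr : 0 ≤ r) : 0 < unitRadius r :=
  mul_pos (sub_pos.2 (sqrt_lt_sqrt_half_add hr)) (Real.sqrt_pos.2 (by positivity))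

theorem unitRadius_mul_cos {r : ℝ} :
    unitRadius r * Real.cos (alphaStar r) = √(1 / 2 + r) - √r := by
  have hpos : 0 < √(1 + Real.tan (alphaStar r) ^ 2) := Real.sqrt_pos.2 (by positivity)
  have : Real.cos (alphaStar r) = 1 / √(1 + Real.tan (alphaStar r) ^ 2) := by
    rw [alphaStar, Real.tan_arctan, Real.cos_arctan]
  rw [this, unitRadius]
  field_simp

theorem cos_alphaStar_pos (r : ℝ) : 0 < Real.cos (alphaStar r) := Real.cos_arctan_pos _

theorem unitRadius_mul_sin {r : ℝ} (hr : 0 ≤ r) :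
    unitRadius r * Real.sin (alphaStar r) = √r := by
  have h := tan_alphaStar hr
  have hlt := sqrt_lt_sqrt_half_add hr
  rw [Real.tan_eq_sin_div_cos, div_eq_div_iff (cos_alphaStar_pos r).ne' (by linarith),
    ← unitRadius_mul_cos] at h
  exact mul_right_cancel₀ (cos_alphaStar_pos r).ne' (by linear_combination h)

/-- With `w = √(1/2 + r) - √r` and `s = √r` this is half the hexagon's area `2 w (w + 2 s)`. -/
theorem unit_area {r : ℝ} (hr : 0 ≤ r) :
    (√(1 / 2 + r) - √r) * (√(1 / 2 + r) + √r) = 1 / 2 := by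
  linear_combination Real.sq_sqrt (show 0 ≤ 1 / 2 + r by linarith) - Real.sq_sqrt hr

/-- Substituting `cos = w / R` and `sin = s / R` for the unit-area hexagon turns the trigonometric
quotient into a rational function of `w` and `s`; the area relation and `w² + s² = R²` reduce it to
`(w + s)³ - s³`. -/
theorem gBar_eq {r : ℝ} (hr : 0 ≤ r) : gBar r = (travelConst r)⁻¹ := by
  have hR := unitRadius_pos hr
  have hlt := sqrt_lt_sqrt_half_add hr
  have harea := unit_area hr
  have hw := unitRadius_mul_cos (r := r)
  have hs := unitRadius_mul_sin hr
  have hs0 := Real.sqrt_nonneg r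
  set R := unitRadius r
  set w := √(1 / 2 + r) - √r with hwdef
  set s := √r with hsdef
  have hw0 : 0 < w := sub_pos.2 hlt
  have hc : √(1 / 2 + r) = w + s := by rw [hwdef]; ring
  clear_value R w s
  have hcos : Real.cos (alphaStar r) = w / R := by rw [← hw]; field_simp
  have hsin : Real.sin (alphaStar r) = s / R := by rw [← hs]; field_simp
  have hpyth : w ^ 2 + s ^ 2 = R ^ 2 := by
    have := Real.sin_sq_add_cos_sq (alphaStar r)
    rw [← hw, ← hs]
    linear_combination R ^ 2 * this
  have hprod : 2 * (w / R) * (2 * (s / R) + w / R) = R⁻¹ ^ 2 := by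
    rw [hc] at harea
    field_simp
    linear_combination 2 * harea
  have hv : 0 < 2 * (s / R) + w / R := by positivity
  -- Splitting off one full factor leaves the square root of `hprod`, which is a perfect square
  -- because the area is one.
  have hnum : (2 * (w / R)) ^ (1 / 2 : ℝ) * (2 * (s / R) + w / R) ^ (3 / 2 : ℝ) =
      R⁻¹ * (2 * (s / R) + w / R) := by
    rw [show (3 / 2 : ℝ) = 1 / 2 + 1 by norm_num, Real.rpow_add hv, Real.rpow_one, ← mul_assoc,
      ← Real.mul_rpow (by positivity) hv.le, hprod, ← Real.sqrt_eq_rpow,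
      Real.sqrt_sq (by positivity)]
  have hden : 3 * Real.sin (2 * alphaStar r) - 2 * Real.cos (2 * alphaStar r) + 4 =
      (6 * s * w + 2 * w ^ 2 + 6 * s ^ 2) / R ^ 2 := by
    rw [Real.sin_two_mul, Real.cos_two_mul, hcos, hsin]
    field_simp
    linear_combination (-6 : ℝ) * hpyth
  have hunit : R⁻¹ * (2 * (s / R) + w / R) = (2 * s + w) / R ^ 2 := by
    field_simp
  have hpos : 0 < (w + s) ^ 3 - s ^ 3 := by
    have : (w + s) ^ 3 - s ^ 3 = w * (w ^ 2 + 3 * w * s + 3 * s ^ 2) := by ring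
    rw [this]
    positivity
  have hpos2 : 0 < 6 * s * w + 2 * w ^ 2 + 6 * s ^ 2 := by positivity
  rw [hc] at harea
  rw [gBar, hden, hcos, hsin, mul_assoc, hnum, travelConst, hc, ← hsdef, hunit, ← mul_div_assoc,
    div_div_div_cancel_right₀ (by positivity), inv_eq_one_div,
    div_eq_div_iff hpos2.ne' (by positivity)]
  linear_combination (4 * w ^ 2 + 12 * s * w + 12 * s ^ 2) * harea

/-! ### The lower bound -/

theorem three_mul_cbrt_le {x y : ℝ} (hx : 0 ≤ x) (hy : 0 ≤ y) :
    3 * (x * y ^ 2) ^ (1 / 3 : ℝ) ≤ x + 2 * y := by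
  have h : ((x * y ^ 2) ^ (1 / 3 : ℝ)) ^ 3 = x * y ^ 2 := by
    rw [← Real.rpow_natCast, ← Real.rpow_mul (by positivity)]
    norm_num
  refine (pow_le_pow_iff_left₀ (by positivity) (by positivity) (n := 3) (by norm_num)).1 ?_
  rw [mul_pow, h]
  -- `(x + 2y)³ - 27 x y² = (x - y)² (x + 8y)`.
  nlinarith [mul_nonneg (sq_nonneg (x - y)) (show 0 ≤ x + 8 * y by positivity)]

/-- The hypothesis `hO` bounds outbound travel with cone height `c q` and tangent point `σ q`. The
coefficient of `T` is then exactly offset by the inbound cost, and `hc` collapses the remainder to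
`4/3 (c³ - σ³)`. The `1 / N` term appears because `N` facilities have only `N - 1` open tour steps.
-/
theorem cost_ge {κ f c σ q N O T Λ : ℝ} (hκ : 0 < κ) (hf : 0 < f) (hq : 0 < q) (hN : 0 < N)
    (hO : c * q * (q ^ 2 * N) ≤ O + 2 / 3 * (c * q) ^ 3 * N -
      2 / 3 * ((N - 1) * (3 * (σ * q) ^ 2 * (c * q) - 2 * (σ * q) ^ 3) - 3 * (σ * q) ^ 2 * T))
    (hΛ : 2 * T ≤ Λ) (hc : c ^ 2 = 1 / 2 + σ ^ 2) :
    f / q ^ 2 + f * κ * q * (4 / 3 * (c ^ 3 - σ ^ 3) - (2 * σ ^ 2 * c - 4 / 3 * σ ^ 3) / N) ≤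
      f / (q ^ 2 * N) * (N + κ * O) + κ * σ ^ 2 * f / N * Λ := by
  have h1 : κ * σ ^ 2 * f / N * (2 * T) ≤ κ * σ ^ 2 * f / N * Λ := by gcongr
  have h2 : f / (q ^ 2 * N) * (N + κ * (c * q * (q ^ 2 * N) - (2 / 3 * (c * q) ^ 3 * N -
      2 / 3 * ((N - 1) * (3 * (σ * q) ^ 2 * (c * q) - 2 * (σ * q) ^ 3) - 3 * (σ * q) ^ 2 * T)))) ≤
      f / (q ^ 2 * N) * (N + κ * O) := by
    gcongr
    linarith
  refine le_trans (le_of_eq ?_) (add_le_add h2 h1)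
  field_simp
  linear_combination (6 * q ^ 3 * κ * c * N) * hc

/-- Convexity: for `t ≥ 0`, `t³ - 3 s² t + 2 s³ = (t - s)² (t + 2 s)`. The tangent is increasing, so
it may then be evaluated at `ρ - u ≤ t`. -/
theorem tangent_le_cube {ρ s u : ℝ} (hs : 0 ≤ s) :
    3 * s ^ 2 * (ρ - u) - 2 * s ^ 3 ≤ max (ρ - u) 0 ^ 3 := by
  have h1 := le_max_left (ρ - u) 0
  have h2 := le_max_right (ρ - u) 0
  generalize max (ρ - u) 0 = t at *
  nlinarith [mul_nonneg (sq_nonneg (t - s)) (show 0 ≤ t + 2 * s by positivity),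
    mul_nonneg (sq_nonneg s) (sub_nonneg.2 h1)]

/-- The lower bound on the average cost of the first `n + 1` facilities. -/
noncomputable def finiteBound (κ f r : ℝ) (n : ℕ) : ℝ :=
  3 * (κ ^ 2 * f ^ 3 * (travelConst r - (2 * √r ^ 2 * √(1 / 2 + r) - 4 / 3 * √r ^ 3) / (n + 1)) ^ 2
    / 4) ^ (1 / 3 : ℝ)

theorem FacilityDesign.finiteBound_le_avgCost (D : FacilityDesign) {κ f r : ℝ} (hκ : 0 < κ)
    (hf : 0 < f) (hr : 0 ≤ r) (n : ℕ)
    (hn : 0 ≤ travelConst r - (2 * √r ^ 2 * √(1 / 2 + r) - 4 / 3 * √r ^ 3) / (n + 1)) :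
    ENNReal.ofReal (finiteBound κ f r n) ≤ D.avgCost κ f r (n + 1) := by
  set C := travelConst r - (2 * √r ^ 2 * √(1 / 2 + r) - 4 / 3 * √r ^ 3) / (n + 1) with hC
  set S := ∑ i ∈ Finset.range (n + 1), volume (D.region i) with hS
  have hStop : S ≠ ⊤ := ENNReal.sum_ne_top.2 fun i _ => (D.area_lt_top i).ne
  have hsetup : ∑ i ∈ Finset.range (n + 1), (1 + ENNReal.ofReal κ * D.outbound i) =
      ((n + 1 : ℕ) : ENNReal) + ENNReal.ofReal κ * ∑ i ∈ Finset.range (n + 1), D.outbound i := by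
    rw [Finset.sum_add_distrib, ← Finset.mul_sum]
    simp
  unfold FacilityDesign.avgCost
  rw [← hS, hsetup]
  have hf' : ENNReal.ofReal f ≠ 0 := by simpa using hf
  have hκ' : ENNReal.ofReal κ ≠ 0 := by simpa using hκ
  -- Zero total area or infinite outbound travel makes the cost `⊤`; otherwise everything is a real
  -- number.
  rcases eq_or_ne S 0 with hS0 | hS0
  · rw [hS0, ENNReal.div_zero hf', ENNReal.top_mul (by simp), top_add]
    exact le_top
  set Ω := ∑ i ∈ Finset.range (n + 1), D.outbound i with hΩ
  rcases eq_or_ne Ω ⊤ with hΩtop | hΩtop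
  · rw [hΩtop, ENNReal.mul_top hκ', add_top, ENNReal.mul_top, top_add]
    · exact le_top
    · exact (ENNReal.div_pos hf' hStop).ne'
  have hN : (0 : ℝ) < n + 1 := by positivity
  -- `q²` is the mean area per facility.
  set q := √(S.toReal / (n + 1)) with hq
  have hSpos : 0 < S.toReal := ENNReal.toReal_pos hS0 hStop
  have hqpos : 0 < q := Real.sqrt_pos.2 (by positivity)
  have hSq : S.toReal = q ^ 2 * (n + 1) := by
    rw [hq, Real.sq_sqrt (by positivity)]
    field_simp
  set c := √(1 / 2 + r)
  set σ := √r
  have hσ2 : σ ^ 2 = r := Real.sq_sqrt hr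
  have hc2 : c ^ 2 = 1 / 2 + σ ^ 2 := by
    rw [hσ2]; exact Real.sq_sqrt (by linarith)
  have hσ0 : 0 ≤ σ := Real.sqrt_nonneg _
  have hc0 : 0 ≤ c := Real.sqrt_nonneg _
  set u : ℕ → ℝ := fun i => l1Dist (D.site i) (D.site (i + 1)) / 2 with hu
  have hu0 : ∀ i, 0 ≤ u i := fun i => div_nonneg (l1Dist_nonneg _ _) (by norm_num)
  have hρ : 0 ≤ c * q := by positivity
  have hcube : ∀ i, 0 ≤ 2 / 3 * ((c * q) ^ 3 - max (c * q - u i) 0 ^ 3) := by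
    intro i
    have : max (c * q - u i) 0 ≤ c * q := max_le (by linarith [hu0 i]) hρ
    have := pow_le_pow_left₀ (le_max_right _ _) this 3
    linarith
  have hmain := D.mul_sum_area_le hρ n
  rw [← hS, ← hΩ, ← ENNReal.ofReal_sum_of_nonneg fun i _ => hcube i, ← ENNReal.ofReal_toReal hStop,
    ← ENNReal.ofReal_toReal hΩtop, ← ENNReal.ofReal_mul hρ,
    ← ENNReal.ofReal_add (by positivity) (Finset.sum_nonneg fun i _ => hcube i),
    ← ENNReal.ofReal_add (by positivity)
      (add_nonneg (by positivity) (Finset.sum_nonneg fun i _ => hcube i)),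
    ENNReal.ofReal_le_ofReal_iff (add_nonneg (by positivity)
      (add_nonneg (by positivity) (Finset.sum_nonneg fun i _ => hcube i)))] at hmain
  -- From here the bound depends on the tour only through the sum of the `u i`.
  have hsum : ∑ i ∈ Finset.range n, 2 / 3 * ((c * q) ^ 3 - max (c * q - u i) 0 ^ 3) ≤
      ∑ i ∈ Finset.range n, 2 / 3 * ((c * q) ^ 3 -
        (3 * (σ * q) ^ 2 * (c * q - u i) - 2 * (σ * q) ^ 3)) := by
    gcongr with i
    exact tangent_le_cube (by positivity)
  have hsum2 : ∑ i ∈ Finset.range n, 2 / 3 * ((c * q) ^ 3 -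
        (3 * (σ * q) ^ 2 * (c * q - u i) - 2 * (σ * q) ^ 3)) =
      n * (2 / 3 * ((c * q) ^ 3 - 3 * (σ * q) ^ 2 * (c * q) + 2 * (σ * q) ^ 3)) +
        2 * (σ * q) ^ 2 * ∑ i ∈ Finset.range n, u i := by
    rw [Finset.mul_sum, ← nsmul_eq_mul]
    conv_rhs => rw [← Finset.card_range n, ← Finset.sum_const, Finset.card_range,
      ← Finset.sum_add_distrib]
    refine Finset.sum_congr rfl fun i _ => ?_
    ring
  have htour : 2 * ∑ i ∈ Finset.range n, u i ≤
      ∑ i ∈ Finset.range (n + 1), D.inboundLength (n + 1) i := by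
    rw [D.sum_inboundLength, Finset.mul_sum]
    simp only [hu, mul_div_cancel₀ _ (two_ne_zero' ℝ)]
    linarith [l1Dist_nonneg (D.site n) (D.site 0)]
  set T := ∑ i ∈ Finset.range n, u i
  set Λ := ∑ i ∈ Finset.range (n + 1), D.inboundLength (n + 1) i
  have hT : 0 ≤ T := Finset.sum_nonneg fun i _ => hu0 i
  have hΛ : 0 ≤ Λ := le_trans (by positivity) htour
  have hcost := cost_ge (κ := κ) (f := f) (N := n + 1) (O := Ω.toReal) (T := T) (Λ := Λ)
    (c := c) (σ := σ) hκ hf hqpos hN (by rw [← hSq]; linarith) htour hc2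
  have hreal : ENNReal.ofReal f / S * (((n + 1 : ℕ) : ENNReal) + ENNReal.ofReal κ * Ω) +
      ENNReal.ofReal (κ * r * f / ((n + 1 : ℕ) : ℝ) * Λ) =
      ENNReal.ofReal (f / (q ^ 2 * (n + 1)) * (n + 1 + κ * Ω.toReal) +
        κ * σ ^ 2 * f / (n + 1) * Λ) := by
    rw [ENNReal.ofReal_add (by positivity) (by positivity), ENNReal.ofReal_mul (p := f / (q ^ 2 * (n + 1))) (by positivity),
      ENNReal.ofReal_div_of_pos (by positivity), ENNReal.ofReal_add (by positivity) (by positivity),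
      ENNReal.ofReal_mul (p := κ) hκ.le, ENNReal.ofReal_toReal hΩtop, ← hSq, ENNReal.ofReal_toReal hStop,
      hσ2]
    congr 3
    · rw [← Nat.cast_succ, ENNReal.ofReal_natCast]
    · push_cast
      rfl
  rw [hreal]
  refine ENNReal.ofReal_le_ofReal (le_trans ?_ hcost)
  -- The product `x y²` is free of `q`, so the bound holds whatever the mean area is.
  have hamgm := three_mul_cbrt_le (x := f / q ^ 2) (y := f * κ * q * C / 2) (by positivity)
    (by positivity)
  unfold finiteBound
  refine le_trans (le_of_eq ?_) (hamgm.trans (le_of_eq ?_))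
  · congr 2
    rw [← hC]
    field_simp
    ring
  · rw [hC, travelConst]
    ring

theorem tendsto_finiteBound (κ f : ℝ) {r : ℝ} (hr : 0 ≤ r) :
    Tendsto (finiteBound κ f r) atTop (𝓝 (optCost κ f r)) := by
  have h0 : Tendsto (fun n : ℕ => (2 * √r ^ 2 * √(1 / 2 + r) - 4 / 3 * √r ^ 3) / ((n : ℝ) + 1))
      atTop (𝓝 0) :=
    tendsto_const_nhds.div_atTop (tendsto_atTop_add_const_right _ _ tendsto_natCast_atTop_atTop)
  have h1 : Tendsto (fun n : ℕ => κ ^ 2 * f ^ 3 * (travelConst r -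
      (2 * √r ^ 2 * √(1 / 2 + r) - 4 / 3 * √r ^ 3) / ((n : ℝ) + 1)) ^ 2 / 4) atTop
      (𝓝 (κ ^ 2 * f ^ 3 * (travelConst r - 0) ^ 2 / 4)) :=
    (((tendsto_const_nhds.sub h0).pow 2).const_mul _).div_const _
  have h2 := (h1.rpow_const (p := 1 / 3) (Or.inr (by norm_num))).const_mul 3
  have h3 : optCost κ f r =
      3 * (κ ^ 2 * f ^ 3 * (travelConst r - 0) ^ 2 / 4) ^ (1 / 3 : ℝ) := by
    rw [optCost, gBar_eq hr]
    congr 2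
    have := (travelConst_pos hr).ne'
    field_simp
    ring
  rw [h3]
  exact h2

theorem FacilityDesign.optCost_le_liminf (D : FacilityDesign) {κ f r : ℝ} (hκ : 0 < κ)
    (hf : 0 < f) (hr : 0 ≤ r) :
    ENNReal.ofReal (optCost κ f r) ≤ liminf (D.avgCost κ f r) atTop := by
  have h0 : Tendsto (fun n : ℕ => travelConst r -
      (2 * √r ^ 2 * √(1 / 2 + r) - 4 / 3 * √r ^ 3) / ((n : ℝ) + 1)) atTop
      (𝓝 (travelConst r - 0)) :=
    tendsto_const_nhds.sub (tendsto_const_nhds.div_atTop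
      (tendsto_atTop_add_const_right _ _ tendsto_natCast_atTop_atTop))
  -- The corrected constant tends to `travelConst r > 0`, so its nonnegativity, needed for AM-GM,
  -- holds eventually.
  have hev : ∀ᶠ n : ℕ in atTop,
      ENNReal.ofReal (finiteBound κ f r n) ≤ D.avgCost κ f r (n + 1) := by
    filter_upwards [h0.eventually_const_lt (by simpa using travelConst_pos hr)] with n hn
    exact D.finiteBound_le_avgCost hκ hf hr n hn.le
  have hlim := (ENNReal.continuous_ofReal.tendsto _).comp (tendsto_finiteBound κ f hr)
  rw [← hlim.liminf_eq, ← liminf_nat_add (D.avgCost κ f r) 1]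
  exact liminf_le_liminf hev

/-! ### A tour through `ℤ × ℤ` almost all of whose steps are horizontal

The points `(x, y)` with `y + ⌊√|x|⌋ = n`, `y ≥ 0`, are visited from right to left, then their
mirror images `(x, -1 - y)` from left to right; after that the tour moves on to level `n + 1`. -/

/-- `⌊√|x|⌋`. -/
def absSqrt (x : ℤ) : ℤ := (Nat.sqrt x.natAbs : ℤ)

theorem absSqrt_nonneg (x : ℤ) : 0 ≤ absSqrt x := Int.natCast_nonneg _

theorem absSqrt_neg (x : ℤ) : absSqrt (-x) = absSqrt x := by
  simp [absSqrt]

theorem absSqrt_mono {x y : ℤ} (h : |x| ≤ |y|) : absSqrt x ≤ absSqrt y := by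
  unfold absSqrt
  exact_mod_cast Nat.sqrt_le_sqrt (by zify; exact h)

theorem absSqrt_le {x : ℤ} {n : ℕ} (h : |x| < ((n : ℤ) + 1) ^ 2) : absSqrt x ≤ n := by
  unfold absSqrt
  have : Nat.sqrt x.natAbs < n + 1 := by
    rw [Nat.sqrt_lt']
    zify
    exact h
  omega

theorem abs_lt_of_absSqrt_le {x : ℤ} {n : ℕ} (h : absSqrt x ≤ n) : |x| < ((n : ℤ) + 1) ^ 2 := by
  unfold absSqrt at h
  have : Nat.sqrt x.natAbs < n + 1 := by omega
  rw [Nat.sqrt_lt'] at this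
  zify at this
  exact this

theorem absSqrt_sq_sub_one (n : ℕ) : absSqrt (((n : ℤ) + 1) ^ 2 - 1) = n := by
  unfold absSqrt
  have : (((n : ℤ) + 1) ^ 2 - 1).natAbs = n * n + 2 * n := by
    rw [show ((n : ℤ) + 1) ^ 2 - 1 = ((n * n + 2 * n : ℕ) : ℤ) by push_cast; ring, Int.natAbs_natCast]
  rw [this]
  congr 1
  exact Nat.sqrt_add_eq n (by omega)

/-- `sign x * ⌊√|x|⌋`. -/
def signSqrt (x : ℤ) : ℤ := if 0 ≤ x then absSqrt x else -absSqrt x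

/-- `signSqrt` is nondecreasing and its increments dominate the absolute increments of `absSqrt`, so
vertical movement along a level is bounded by a telescoping sum. -/
theorem abs_absSqrt_sub_le (x : ℤ) :
    |absSqrt (x + 1) - absSqrt x| ≤ signSqrt (x + 1) - signSqrt x := by
  unfold signSqrt
  have h0 := absSqrt_nonneg x
  have h1 := absSqrt_nonneg (x + 1)
  rcases lt_trichotomy x (-1) with h | h | h
  · rw [if_neg (by omega), if_neg (by omega)]
    have := absSqrt_mono (x := x + 1) (y := x) (by rw [abs_of_neg, abs_of_neg] <;> omega)
    rw [abs_of_nonpos (by linarith)]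
    linarith
  · subst h
    norm_num [absSqrt]
  · rw [if_pos (by omega), if_pos (by omega)]
    have := absSqrt_mono (x := x) (y := x + 1) (by rw [abs_of_nonneg, abs_of_nonneg] <;> omega)
    rw [abs_of_nonneg (by linarith)]

/-- Identify both closed half planes of `ℤ × ℤ` with the upper one. -/
def foldHeight (y : ℤ) : ℤ := if 0 ≤ y then y else -1 - y

theorem foldHeight_nonneg (y : ℤ) : 0 ≤ foldHeight y := by
  unfold foldHeight
  split_ifs <;> omega

/-- Level `n` has one point in each half plane for every `x` with `|x| < (n + 1)²`, hence `4 (n +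
1)² - 2` points. -/
def tourLevel (p : ℤ × ℤ) : ℕ := (foldHeight p.2 + absSqrt p.1).toNat

theorem coe_tourLevel (p : ℤ × ℤ) : (tourLevel p : ℤ) = foldHeight p.2 + absSqrt p.1 :=
  Int.toNat_of_nonneg (add_nonneg (foldHeight_nonneg _) (absSqrt_nonneg _))

theorem abs_fst_lt (p : ℤ × ℤ) : |p.1| < ((tourLevel p : ℤ) + 1) ^ 2 :=
  abs_lt_of_absSqrt_le (by have := foldHeight_nonneg p.2; rw [coe_tourLevel]; omega)

/-- The number of points on levels less than `n`. -/
def tourOffset (n : ℕ) : ℤ := ∑ k ∈ Finset.range n, (4 * ((k : ℤ) + 1) ^ 2 - 2)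

theorem tourOffset_succ (n : ℕ) :
    tourOffset (n + 1) = tourOffset n + (4 * ((n : ℤ) + 1) ^ 2 - 2) := Finset.sum_range_succ _ _

theorem cube_le_tourOffset (n : ℕ) : (n : ℤ) ^ 3 ≤ tourOffset n := by
  induction n with
  | zero => simp [tourOffset]
  | succ k ih =>
    rw [tourOffset_succ]
    push_cast
    have := Int.natCast_nonneg k
    nlinarith

theorem tourOffset_mono : Monotone tourOffset :=
  monotone_nat_of_le_succ fun n => by
    rw [tourOffset_succ]
    have := Int.natCast_nonneg n
    nlinarith

/-- The position of a point on the tour. -/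
def tourRank (p : ℤ × ℤ) : ℤ :=
  tourOffset (tourLevel p) + if 0 ≤ p.2 then ((tourLevel p : ℤ) + 1) ^ 2 - 1 - p.1
    else 3 * ((tourLevel p : ℤ) + 1) ^ 2 - 2 + p.1

theorem tourOffset_le_tourRank (p : ℤ × ℤ) : tourOffset (tourLevel p) ≤ tourRank p := by
  have := abs_lt.1 (abs_fst_lt p)
  unfold tourRank
  split_ifs <;> nlinarith

theorem tourRank_lt (p : ℤ × ℤ) : tourRank p < tourOffset (tourLevel p + 1) := by
  have := abs_lt.1 (abs_fst_lt p)
  rw [tourOffset_succ]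
  unfold tourRank
  split_ifs <;> nlinarith

/-- Levels occupy disjoint intervals of ranks. Within a level the upper points come before the lower
ones, so the rank determines the half plane and `x`, and then the level determines `y`. -/
theorem tourRank_injective : Function.Injective tourRank := by
  intro p q h
  have hlevel : tourLevel p = tourLevel q := by
    by_contra hne
    rcases lt_or_gt_of_ne hne with hlt | hlt
    · have := tourOffset_mono (Nat.succ_le_of_lt hlt)
      have := tourRank_lt p
      have := tourOffset_le_tourRank q
      simp only [Nat.succ_eq_add_one] at *
      omega
    · have := tourOffset_mono (Nat.succ_le_of_lt hlt)
      have := tourRank_lt q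
      have := tourOffset_le_tourRank p
      simp only [Nat.succ_eq_add_one] at *
      omega
  have hp := abs_lt.1 (abs_fst_lt p)
  have hq := abs_lt.1 (abs_fst_lt q)
  have cp := coe_tourLevel p
  have cq := coe_tourLevel q
  unfold tourRank at h
  rw [hlevel] at h hp cp
  unfold foldHeight at cp cq
  generalize ((tourLevel q : ℤ) + 1) ^ 2 = m at *
  have hx : p.1 = q.1 := by split_ifs at h <;> omega
  rw [hx] at cp
  refine Prod.ext hx ?_
  split_ifs at h cp cq <;> omega

/-- A bound for the vertical movement on the tour before `p`. -/
def tourExcess (p : ℤ × ℤ) : ℤ :=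
  3 * (tourLevel p : ℤ) ^ 2 + tourLevel p + if 0 ≤ p.2 then tourLevel p - signSqrt p.1
    else 3 * tourLevel p + 1 + signSqrt p.1

theorem abs_signSqrt (x : ℤ) : |signSqrt x| = absSqrt x := by
  have := absSqrt_nonneg x
  unfold signSqrt
  split_ifs
  · exact abs_of_nonneg this
  · rw [abs_neg, abs_of_nonneg this]

theorem tourExcess_le (p : ℤ × ℤ) : tourExcess p ≤ 3 * ((tourLevel p : ℤ) + 1) ^ 2 := by
  have h1 := abs_le.1 (abs_signSqrt p.1).le
  have h2 := coe_tourLevel p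
  have h3 := foldHeight_nonneg p.2
  unfold tourExcess
  split_ifs <;> nlinarith

/-- The upper (`b = true`) or lower point of level `n` with abscissa `x`. -/
def tourPoint (b : Bool) (n : ℕ) (x : ℤ) : ℤ × ℤ :=
  (x, if b then n - absSqrt x else -1 - (n - absSqrt x))

theorem tourPoint_tourLevel (p : ℤ × ℤ) :
    p = tourPoint (decide (0 ≤ p.2)) (tourLevel p) p.1 := by
  have h := coe_tourLevel p
  refine Prod.ext rfl ?_
  simp only [tourPoint, decide_eq_true_eq, h, foldHeight]
  split_ifs <;> omega

theorem tourPoint_spec {b : Bool} {n : ℕ} {x : ℤ} (hx : |x| < ((n : ℤ) + 1) ^ 2) :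
    tourRank (tourPoint b n x) = tourOffset n + (if b then ((n : ℤ) + 1) ^ 2 - 1 - x
      else 3 * ((n : ℤ) + 1) ^ 2 - 2 + x) ∧
    tourExcess (tourPoint b n x) = 3 * (n : ℤ) ^ 2 + n + (if b then n - signSqrt x
      else 3 * n + 1 + signSqrt x) := by
  have h := absSqrt_le hx
  have hb : 0 ≤ (tourPoint b n x).2 ↔ b = true := by
    cases b <;> simp [tourPoint] <;> omega
  have hl : tourLevel (tourPoint b n x) = n := by
    zify
    rw [coe_tourLevel, foldHeight]
    simp only [hb]
    cases b <;> simp [tourPoint]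
  unfold tourRank tourExcess
  simp only [hl, hb]
  exact ⟨rfl, rfl⟩

/-- `tourExcess` serves as a potential: its increase pays for the vertical move and for all
horizontal movement beyond one unit. The cases are a step inside the upper or lower half, the turn
at the left end, and the jump to the next level. -/
theorem exists_tour_next (p : ℤ × ℤ) : ∃ q, tourRank q = tourRank p + 1 ∧
    |q.2 - p.2| ≤ tourExcess q - tourExcess p ∧
    |q.1 - p.1| + |q.2 - p.2| ≤ 1 + (tourExcess q - tourExcess p) := by
  obtain ⟨b, n, x, hx, rfl⟩ : ∃ (b : Bool) (n : ℕ) (x : ℤ),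
      |x| < ((n : ℤ) + 1) ^ 2 ∧ p = tourPoint b n x :=
    ⟨_, _, _, abs_fst_lt p, tourPoint_tourLevel p⟩
  obtain ⟨hr, he⟩ := tourPoint_spec (b := b) hx
  have hx' := abs_lt.1 hx
  have hlast := absSqrt_sq_sub_one n
  cases b with
  | true =>
    by_cases h : 1 - ((n : ℤ) + 1) ^ 2 < x
    · obtain ⟨hr', he'⟩ := tourPoint_spec (b := true) (n := n) (x := x - 1)
        (abs_lt.2 ⟨by omega, by omega⟩)
      have hv := abs_absSqrt_sub_le (x - 1)
      rw [sub_add_cancel] at hv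
      refine ⟨tourPoint true n (x - 1), ?_, ?_, ?_⟩
      · rw [hr', hr]
        simp only [if_true]
        ring
      all_goals
        rw [he', he]
        simp only [tourPoint, if_true]
        rw [show (n : ℤ) - absSqrt (x - 1) - (n - absSqrt x) = absSqrt x - absSqrt (x - 1) by ring]
      · linarith
      · rw [show x - 1 - x = -1 by ring]
        norm_num
        linarith
    -- At the left end the tour drops from height `0` to `-1` in the same column.
    · obtain rfl : x = -(((n : ℤ) + 1) ^ 2 - 1) := by omega
      obtain ⟨hr', he'⟩ := tourPoint_spec (b := false) hx
      refine ⟨tourPoint false n (-(((n : ℤ) + 1) ^ 2 - 1)), ?_, ?_, ?_⟩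
      · rw [hr', hr]
        simp only [if_true, Bool.false_eq_true, if_false]
        ring
      all_goals
        rw [he', he]
        simp only [tourPoint, if_true, Bool.false_eq_true, if_false, absSqrt_neg, hlast]
        have := abs_le.1 (abs_signSqrt (-(((n : ℤ) + 1) ^ 2 - 1))).le
        rw [absSqrt_neg, hlast] at this
        generalize signSqrt _ = t at this ⊢
        norm_num
        linarith
  | false =>
    by_cases h : x < ((n : ℤ) + 1) ^ 2 - 1
    · obtain ⟨hr', he'⟩ := tourPoint_spec (b := false) (n := n) (x := x + 1)
        (abs_lt.2 ⟨by omega, by omega⟩)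
      have hv := abs_absSqrt_sub_le x
      refine ⟨tourPoint false n (x + 1), ?_, ?_, ?_⟩
      · rw [hr', hr]
        simp only [Bool.false_eq_true, if_false]
        ring
      all_goals
        rw [he', he]
        simp only [tourPoint, Bool.false_eq_true, if_false]
        rw [show -1 - ((n : ℤ) - absSqrt (x + 1)) - (-1 - (n - absSqrt x)) =
          absSqrt (x + 1) - absSqrt x by ring]
      · linarith
      · rw [show x + 1 - x = 1 by ring]
        norm_num
        linarith
    -- The jump to the next level spans `2 n + 3` columns and one row; the potential rises by
    -- exactly `2 n + 3`.
    · obtain rfl : x = ((n : ℤ) + 1) ^ 2 - 1 := by omega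
      have hlast' := absSqrt_sq_sub_one (n + 1)
      have hn := Int.natCast_nonneg n
      have hpos : (0 : ℤ) ≤ ((n + 1 : ℕ) + 1 : ℤ) ^ 2 - 1 := by push_cast; nlinarith
      obtain ⟨hr', he'⟩ := tourPoint_spec (b := true) (n := n + 1)
        (x := ((n + 1 : ℕ) + 1 : ℤ) ^ 2 - 1) (by rw [abs_of_nonneg hpos]; linarith)
      have hs' : signSqrt (((n + 1 : ℕ) + 1 : ℤ) ^ 2 - 1) = (n + 1 : ℕ) := by
        rw [signSqrt, if_pos hpos, hlast']
      have hs : signSqrt ((n + 1 : ℤ) ^ 2 - 1) = n := by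
        rw [signSqrt, if_pos (by nlinarith), hlast]
      have hdiff : ((n + 1 : ℕ) + 1 : ℤ) ^ 2 - 1 - (((n : ℤ) + 1) ^ 2 - 1) = 2 * n + 3 := by
        push_cast
        ring
      refine ⟨tourPoint true (n + 1) (((n + 1 : ℕ) + 1 : ℤ) ^ 2 - 1), ?_, ?_, ?_⟩
      · rw [hr', hr, tourOffset_succ]
        simp only [if_true, Bool.false_eq_true, if_false]
        ring
      all_goals
        rw [he', he, hs, hs']
        simp only [tourPoint, if_true, Bool.false_eq_true, if_false, hlast, hlast', hdiff]
        rw [show ((n + 1 : ℕ) : ℤ) - (n + 1 : ℕ) - (-1 - ((n : ℤ) - n)) = 1 by ring, abs_one]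
      · push_cast
        nlinarith
      · rw [abs_of_nonneg (by linarith : (0 : ℤ) ≤ 2 * n + 3)]
        push_cast
        nlinarith

/-! ### Enumeration of the integer lattice along the tour. -/

theorem tourRank_zero : tourRank (0, 0) = 0 := by
  simp [tourRank, tourLevel, foldHeight, absSqrt, tourOffset]

theorem tourExcess_zero : tourExcess (0, 0) = 0 := by
  simp [tourExcess, tourLevel, foldHeight, signSqrt, absSqrt]

theorem exists_tourRank_eq (i : ℕ) : ∃ p, tourRank p = i := by
  induction i with
  | zero => exact ⟨_, tourRank_zero⟩
  | succ k ih =>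
    obtain ⟨p, hp⟩ := ih
    obtain ⟨q, hq, -⟩ := exists_tour_next p
    exact ⟨q, by rw [hq, hp]; push_cast; rfl⟩

/-- The tour. -/
noncomputable def tour (i : ℕ) : ℤ × ℤ := (exists_tourRank_eq i).choose

theorem tourRank_tour (i : ℕ) : tourRank (tour i) = i := (exists_tourRank_eq i).choose_spec

theorem tour_injective : Function.Injective tour := by
  intro i j h
  have := congrArg tourRank h
  rw [tourRank_tour, tourRank_tour] at this
  exact_mod_cast this

theorem tour_surjective : Function.Surjective tour := by
  intro p
  have h0 : 0 ≤ tourRank p :=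
    le_trans (le_trans (by positivity) (cube_le_tourOffset _)) (tourOffset_le_tourRank p)
  refine ⟨(tourRank p).toNat, tourRank_injective ?_⟩
  rw [tourRank_tour, Int.toNat_of_nonneg h0]

theorem tour_zero : tour 0 = (0, 0) :=
  tourRank_injective (by rw [tourRank_tour, tourRank_zero]; rfl)

theorem tour_step (i : ℕ) :
    |(tour (i + 1)).2 - (tour i).2| ≤ tourExcess (tour (i + 1)) - tourExcess (tour i) ∧
    |(tour (i + 1)).1 - (tour i).1| + |(tour (i + 1)).2 - (tour i).2| ≤
      1 + (tourExcess (tour (i + 1)) - tourExcess (tour i)) := by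
  obtain ⟨q, hq, h⟩ := exists_tour_next (tour i)
  obtain rfl : q = tour (i + 1) := by
    apply tourRank_injective
    rw [hq, tourRank_tour, tourRank_tour]
    push_cast
    rfl
  exact h

theorem tourLevel_tour_cube_le (i : ℕ) : tourLevel (tour i) ^ 3 ≤ i := by
  have h := (cube_le_tourOffset _).trans (tourOffset_le_tourRank (tour i))
  rw [tourRank_tour] at h
  exact_mod_cast h

theorem abs_snd_le (p : ℤ × ℤ) : |p.2| ≤ tourLevel p + 1 := by
  have h1 := coe_tourLevel p
  have h2 := absSqrt_nonneg p.1
  unfold foldHeight at h1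
  rw [abs_le]
  split_ifs at h1 <;> constructor <;> omega

/-- The level is at most the cube root of the position, so an error quadratic in the level vanishes
on average. -/
theorem tendsto_tourLevel_sq_div :
    Tendsto (fun i : ℕ => ((tourLevel (tour i) : ℝ) + 1) ^ 2 / (i + 1)) atTop (𝓝 0) := by
  have hcast : Tendsto (fun i : ℕ => (i : ℝ) + 1) atTop atTop :=
    tendsto_atTop_add_const_right _ _ tendsto_natCast_atTop_atTop
  have hlim : Tendsto (fun i : ℕ => 4 * ((i : ℝ) + 1) ^ (-(1 / 3) : ℝ)) atTop (𝓝 (4 * 0)) :=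
    ((tendsto_rpow_neg_atTop (by norm_num : (0 : ℝ) < 1 / 3)).comp hcast).const_mul 4
  rw [mul_zero] at hlim
  refine squeeze_zero (fun i => by positivity) (fun i => ?_) hlim
  have hi : (0 : ℝ) < i + 1 := by positivity
  set t := ((i : ℝ) + 1) ^ (1 / 3 : ℝ) with ht
  have ht0 : 0 < t := Real.rpow_pos_of_pos hi _
  have ht3 : t ^ 3 = i + 1 := by
    rw [ht, ← Real.rpow_natCast, ← Real.rpow_mul hi.le]
    norm_num
  have ht1 : 1 ≤ t := Real.one_le_rpow (by linarith [Nat.cast_nonneg (α := ℝ) i]) (by norm_num)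
  have hl : (tourLevel (tour i) : ℝ) ≤ t := by
    refine (pow_le_pow_iff_left₀ (by positivity) ht0.le (n := 3) (by norm_num)).1 ?_
    rw [ht3]
    have : ((tourLevel (tour i) ^ 3 : ℕ) : ℝ) ≤ i := by exact_mod_cast tourLevel_tour_cube_le i
    push_cast at this
    linarith
  rw [Real.rpow_neg hi.le, ← ht, ← ht3, div_le_iff₀ (by positivity)]
  have h2 : (tourLevel (tour i) : ℝ) + 1 ≤ 2 * t := by linarith
  have h3 := pow_le_pow_left₀ (by positivity) h2 2
  refine h3.trans (le_of_eq ?_)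
  field_simp
  ring

/-! ### The hexagonal tiling -/

/-- The part `|x| ≤ w` of the `L₁` ball of radius `w + s`. -/
def stripBall (w s : ℝ) : Set (ℝ × ℝ) := {p | |p.1| ≤ w ∧ |p.1| + |p.2| ≤ w + s}

theorem isClosed_stripBall (w s : ℝ) : IsClosed (stripBall w s) :=
  (isClosed_le (f := fun p : ℝ × ℝ => |p.1|) (by fun_prop) continuous_const).inter
    (isClosed_le (f := fun p : ℝ × ℝ => |p.1| + |p.2|) (by fun_prop) continuous_const)

theorem elongatedHexagon_eq_stripBall {R α : ℝ} (hc : 0 ≤ R * Real.cos α)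
    (hs : 0 ≤ R * Real.sin α) :
    elongatedHexagon R α = stripBall (R * Real.cos α) (R * Real.sin α) :=
  Set.ext fun p => mem_elongatedHexagon_iff hc hs p

/-- The lattice of the centres of the tiles. -/
def hexLattice (w s : ℝ) (v : ℤ × ℤ) : ℝ × ℝ := (w * (2 * v.1 + v.2), (w + 2 * s) * v.2)

theorem hexLattice_sub (w s : ℝ) (u v : ℤ × ℤ) :
    hexLattice w s (u - v) = hexLattice w s u - hexLattice w s v := by
  ext <;> simp [hexLattice] <;> ring

theorem l1Dist_hexLattice_le {w s : ℝ} (hw : 0 ≤ w) (hs : 0 ≤ s) (u v : ℤ × ℤ) :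
    l1Dist (hexLattice w s u) (hexLattice w s v) ≤
      2 * w * (|u.1 - v.1| + |u.2 - v.2| : ℤ) + 2 * s * (|u.2 - v.2| : ℤ) := by
  have h1 : |w * (2 * (u.1 - v.1 : ℝ) + (u.2 - v.2))| ≤
      w * (2 * |(u.1 - v.1 : ℝ)| + |(u.2 - v.2 : ℝ)|) := by
    rw [abs_mul, abs_of_nonneg hw]
    gcongr
    refine (abs_add_le _ _).trans ?_
    rw [abs_mul, abs_two]
  have h2 : |(w + 2 * s) * (u.2 - v.2 : ℝ)| = (w + 2 * s) * |(u.2 - v.2 : ℝ)| := by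
    rw [abs_mul, abs_of_nonneg (by positivity)]
  simp only [l1Dist, hexLattice]
  push_cast
  rw [show w * (2 * (u.1 : ℝ) + u.2) - w * (2 * v.1 + v.2) =
    w * (2 * (u.1 - v.1 : ℝ) + (u.2 - v.2)) by ring, ← mul_sub, h2]
  linarith

/-- In an adjacent row `2 v.1 + v.2` is odd, so the horizontal offset is at least `w` beside the
vertical `w + 2 s`; two or more rows away the vertical offset suffices. -/
theorem le_abs_hexLattice {w s : ℝ} (hw : 0 ≤ w) (hs : 0 ≤ s) {v : ℤ × ℤ} (hv : v.2 ≠ 0) :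
    2 * (w + s) ≤ |(hexLattice w s v).1| + |(hexLattice w s v).2| := by
  simp only [hexLattice, abs_mul, abs_of_nonneg hw, abs_of_nonneg (show 0 ≤ w + 2 * s by positivity)]
  have hcast1 : |(2 * v.1 + v.2 : ℝ)| = ((|2 * v.1 + v.2| : ℤ) : ℝ) := by push_cast; rfl
  have hcast2 : |(v.2 : ℝ)| = ((|v.2| : ℤ) : ℝ) := by push_cast; rfl
  rw [hcast1, hcast2]
  rcases lt_or_ge |v.2| 2 with h | h
  · have h1 : |v.2| = 1 := by have := abs_pos.2 hv; omega
    have h2 : 1 ≤ |2 * v.1 + v.2| := Int.one_le_abs (by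
      rcases abs_eq (by norm_num : (0 : ℤ) ≤ 1) |>.1 h1 with h | h <;> omega)
    have h3 : (1 : ℝ) ≤ ((|2 * v.1 + v.2| : ℤ) : ℝ) := by exact_mod_cast h2
    rw [h1]
    push_cast at *
    nlinarith
  · have h2 : (2 : ℝ) ≤ ((|v.2| : ℤ) : ℝ) := by exact_mod_cast h
    have h3 : (0 : ℝ) ≤ ((|2 * v.1 + v.2| : ℤ) : ℝ) := by positivity
    nlinarith [mul_nonneg hw h3]

theorem le_abs_hexLattice_fst {w s : ℝ} (hw : 0 ≤ w) {v : ℤ × ℤ} (hv : v.2 = 0) (hv0 : v ≠ 0) :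
    2 * w ≤ |(hexLattice w s v).1| := by
  have h1 : v.1 ≠ 0 := fun h => hv0 (Prod.ext h hv)
  have h2 : (1 : ℝ) ≤ |(v.1 : ℝ)| := by exact_mod_cast Int.one_le_abs h1
  simp only [hexLattice, hv, abs_mul, abs_of_nonneg hw, Int.cast_zero, add_zero, abs_two]
  nlinarith

/-- A reverse triangle inequality: other rows have centres at distance at least twice the ball
radius `w + s`, and centres in the same row are at least twice the strip half-width `w` away. -/
theorem l1_le_of_mem_stripBall {w s : ℝ} (hw : 0 ≤ w) (hs : 0 ≤ s) {p : ℝ × ℝ}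
    (hp : p ∈ stripBall w s) {v : ℤ × ℤ} (hv : v ≠ 0) :
    |p.1| + |p.2| ≤ |p.1 - (hexLattice w s v).1| + |p.2 - (hexLattice w s v).2| := by
  obtain ⟨h1, h2⟩ := hp
  have h3 := abs_sub_abs_le_abs_sub (hexLattice w s v).1 p.1
  have h4 := abs_sub_abs_le_abs_sub (hexLattice w s v).2 p.2
  rw [abs_sub_comm] at h3 h4
  by_cases hv2 : v.2 = 0
  · have h5 := le_abs_hexLattice_fst (s := s) hw hv2 hv
    have h6 : (hexLattice w s v).2 = 0 := by simp [hexLattice, hv2]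
    rw [h6, sub_zero]
    linarith
  · have := le_abs_hexLattice hw hs hv2
    linarith

/-- The same separation leaves no slack for a common point, which must lie on the ball or strip
boundary; hence overlaps are null. -/
theorem boundary_of_mem_two_tiles {w s : ℝ} (hw : 0 ≤ w) (hs : 0 ≤ s) {p : ℝ × ℝ}
    {v : ℤ × ℤ} (hv : v ≠ 0) (hp : p ∈ stripBall w s) (hpv : p - hexLattice w s v ∈ stripBall w s) :
    |p.1| = w ∨ |p.1| + |p.2| = w + s := by
  obtain ⟨h1, h2⟩ := hp
  obtain ⟨h1', h2'⟩ := hpv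
  simp only [Prod.fst_sub, Prod.snd_sub] at h1' h2'
  have h3 := abs_sub_abs_le_abs_sub (hexLattice w s v).1 p.1
  have h4 := abs_sub_abs_le_abs_sub (hexLattice w s v).2 p.2
  rw [abs_sub_comm] at h3 h4
  by_cases hv2 : v.2 = 0
  · have h5 := le_abs_hexLattice_fst (s := s) hw hv2 hv
    exact Or.inl (by linarith)
  · have := le_abs_hexLattice hw hs hv2
    exact Or.inr (by linarith)

/-- Eight neighbours suffice. Horizontal ones give `|a| ≤ w`; those two rows away give `|b| ≤ w + 2
s`, which fixes the signs in the diagonal comparisons, and these give `|a| + |b| ≤ w + s`. -/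
theorem mem_stripBall_of_voronoi {w s : ℝ} (hw : 0 < w) (hs : 0 ≤ s) {p : ℝ × ℝ}
    (h : ∀ v : ℤ × ℤ, v ≠ 0 →
      |p.1| + |p.2| ≤ |p.1 - (hexLattice w s v).1| + |p.2 - (hexLattice w s v).2|) :
    p ∈ stripBall w s := by
  obtain ⟨a, b⟩ := p
  simp only [stripBall, Set.mem_ofPred_eq, hexLattice] at *
  have key : ∀ {a b : ℝ}, 0 ≤ a → 0 ≤ b → a + b ≤ |a - 2 * w| + b →
      a + b ≤ |a - w| + |b - (w + 2 * s)| → a + b ≤ a + |b - 2 * (w + 2 * s)| →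
      a ≤ w ∧ a + b ≤ w + s := by
    intro a b ha hb h1 h2 h3
    have h4 : a ≤ w := by
      rcases abs_cases (a - 2 * w) with h | h <;> linarith
    have h5 : b ≤ w + 2 * s := by
      rcases abs_cases (b - 2 * (w + 2 * s)) with h | h <;> linarith
    refine ⟨h4, ?_⟩
    rw [abs_of_nonpos (by linarith : a - w ≤ 0), abs_of_nonpos (by linarith)] at h2
    linarith
  have hx1 : |a| + |b| ≤ |a - 2 * w| + |b| := by
    have := h (1, 0) (by simp)
    push_cast at this
    ring_nf at this ⊢
    exact this
  have hx2 : |a| + |b| ≤ |a + 2 * w| + |b| := by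
    have := h (-1, 0) (by simp)
    push_cast at this
    ring_nf at this ⊢
    exact this
  have hy1 : |a| + |b| ≤ |a| + |b - 2 * (w + 2 * s)| := by
    have := h (-1, 2) (by simp)
    push_cast at this
    ring_nf at this ⊢
    exact this
  have hy2 : |a| + |b| ≤ |a| + |b + 2 * (w + 2 * s)| := by
    have := h (1, -2) (by simp)
    push_cast at this
    ring_nf at this ⊢
    exact this
  have hd1 : |a| + |b| ≤ |a - w| + |b - (w + 2 * s)| := by
    have := h (0, 1) (by simp)
    push_cast at this
    ring_nf at this ⊢
    exact this
  have hd2 : |a| + |b| ≤ |a + w| + |b - (w + 2 * s)| := by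
    have := h (-1, 1) (by simp)
    push_cast at this
    ring_nf at this ⊢
    exact this
  have hd3 : |a| + |b| ≤ |a - w| + |b + (w + 2 * s)| := by
    have := h (1, -1) (by simp)
    push_cast at this
    ring_nf at this ⊢
    exact this
  have hd4 : |a| + |b| ≤ |a + w| + |b + (w + 2 * s)| := by
    have := h (0, -1) (by simp)
    push_cast at this
    ring_nf at this ⊢
    exact this
  have pos : ∀ t m : ℝ, 0 ≤ t → |t - m| = abs (|t| - m) := fun t m ht => by
    rw [abs_of_nonneg ht]
  have neg : ∀ t m : ℝ, t ≤ 0 → |t + m| = abs (|t| - m) := fun t m ht => by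
    rw [abs_of_nonpos ht, show -t - m = -(t + m) by ring, abs_neg]
  rcases le_total 0 a with ha | ha <;> rcases le_total 0 b with hb | hb
  · rw [pos _ _ ha] at hx1 hd1
    rw [pos _ _ hb] at hy1 hd1
    exact key (abs_nonneg a) (abs_nonneg b) hx1 hd1 hy1
  · rw [pos _ _ ha] at hx1 hd3
    rw [neg _ _ hb] at hy2 hd3
    exact key (abs_nonneg a) (abs_nonneg b) hx1 hd3 hy2
  · rw [neg _ _ ha] at hx2 hd2
    rw [pos _ _ hb] at hy1 hd2
    exact key (abs_nonneg a) (abs_nonneg b) hx2 hd2 hy1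
  · rw [neg _ _ ha] at hx2 hd4
    rw [neg _ _ hb] at hy2 hd4
    exact key (abs_nonneg a) (abs_nonneg b) hx2 hd4 hy2

/-- Rounding places `p` in a `2 w` by `w + 2 s` brick around a centre. A point in a cut-off corner
belongs to the diagonal neighbour, relative to which its coordinates have absolute values `w - |a|`
and `w + 2 s - |b|`. -/
theorem exists_sub_hexLattice_mem {w s : ℝ} (hw : 0 < w) (hs : 0 ≤ s) (p : ℝ × ℝ) :
    ∃ v, p - hexLattice w s v ∈ stripBall w s := by
  have hh : 0 < w + 2 * s := by positivity
  set y := round (p.2 / (w + 2 * s)) with hy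
  set x := round ((p.1 - w * y) / (2 * w)) with hx
  have hy1 : |p.2 - (w + 2 * s) * y| ≤ (w + 2 * s) / 2 := by
    have h := abs_sub_round (p.2 / (w + 2 * s))
    rw [show p.2 - (w + 2 * s) * y = (w + 2 * s) * (p.2 / (w + 2 * s) - y) by field_simp,
      abs_mul, abs_of_pos hh]
    nlinarith
  have hx1 : |p.1 - w * (2 * x + y)| ≤ w := by
    have h := abs_sub_round ((p.1 - w * y) / (2 * w))
    rw [show p.1 - w * (2 * x + y) = 2 * w * ((p.1 - w * y) / (2 * w) - x) by field_simp; ring,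
      abs_mul, abs_of_pos (by positivity)]
    nlinarith
  by_cases hle : |p.1 - w * (2 * x + y)| + |p.2 - (w + 2 * s) * y| ≤ w + s
  · exact ⟨(x, y), hx1, hle⟩
  push Not at hle
  set a := p.1 - w * (2 * x + y) with ha
  set b := p.2 - (w + 2 * s) * y with hb
  have hmem : ∀ a' b' : ℝ, |a'| = w - |a| → |b'| = w + 2 * s - |b| → (a', b') ∈ stripBall w s := by
    intro a' b' h1 h2
    refine ⟨?_, ?_⟩ <;> simp only [h1, h2] <;> linarith [abs_nonneg a]
  have hpos : ∀ t m : ℝ, 0 ≤ t → |t| ≤ m → |t - m| = m - |t| := fun t m ht h => by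
    rw [abs_of_nonneg ht] at *
    rw [abs_of_nonpos (by linarith)]
    ring
  have hneg : ∀ t m : ℝ, t ≤ 0 → |t| ≤ m → |t + m| = m - |t| := fun t m ht h => by
    rw [abs_of_nonpos ht] at *
    rw [abs_of_nonneg (by linarith)]
    ring
  have hb2 : |b| ≤ w + 2 * s := by linarith
  rcases le_total 0 a with h1 | h1 <;> rcases le_total 0 b with h2 | h2
  · refine ⟨(x, y + 1), ?_⟩
    convert hmem _ _ (hpos a w h1 hx1) (hpos b _ h2 hb2) using 1
    ext <;> simp [hexLattice, ha, hb] <;> ring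
  · refine ⟨(x + 1, y - 1), ?_⟩
    convert hmem _ _ (hpos a w h1 hx1) (hneg b _ h2 hb2) using 1
    ext <;> simp [hexLattice, ha, hb] <;> ring
  · refine ⟨(x - 1, y + 1), ?_⟩
    convert hmem _ _ (hneg a w h1 hx1) (hpos b _ h2 hb2) using 1
    ext <;> simp [hexLattice, ha, hb] <;> ring
  · refine ⟨(x, y - 1), ?_⟩
    convert hmem _ _ (hneg a w h1 hx1) (hneg b _ h2 hb2) using 1
    ext <;> simp [hexLattice, ha, hb] <;> ring

/-! ### Area and outbound travel of a tile. -/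

theorem setLIntegral_stripBall (w s : ℝ) {F : ℝ × ℝ → ENNReal} (hF : Measurable F) :
    ∫⁻ p in stripBall w s, F p =
      ∫⁻ x in Set.Icc (-w) w, ∫⁻ y in Set.Icc (-(w + s - |x|)) (w + s - |x|), F (x, y) := by
  rw [← lintegral_indicator (isClosed_stripBall w s).measurableSet, Measure.volume_eq_prod,
    lintegral_prod _ (hF.indicator (isClosed_stripBall w s).measurableSet).aemeasurable,
    ← lintegral_indicator measurableSet_Icc]
  refine lintegral_congr fun x => ?_
  by_cases hx : x ∈ Set.Icc (-w) w
  · rw [Set.indicator_of_mem hx, ← lintegral_indicator measurableSet_Icc]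
    refine lintegral_congr fun y => ?_
    have hiff : (x, y) ∈ stripBall w s ↔ y ∈ Set.Icc (-(w + s - |x|)) (w + s - |x|) := by
      rw [Set.mem_Icc, ← abs_le]
      exact ⟨fun h => by linarith [h.2], fun h => ⟨abs_le.2 hx, by simp only; linarith⟩⟩
    by_cases hy : (x, y) ∈ stripBall w s
    · rw [Set.indicator_of_mem hy, Set.indicator_of_mem (hiff.1 hy)]
    · rw [Set.indicator_of_notMem hy, Set.indicator_of_notMem (mt hiff.2 hy)]
  · rw [Set.indicator_of_notMem hx]
    have : ∀ y, (stripBall w s).indicator F (x, y) = 0 := fun y =>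
      Set.indicator_of_notMem (fun h => hx (abs_le.1 h.1)) _
    simp only [this, lintegral_zero]

theorem volume_stripBall {w s : ℝ} (hw : 0 ≤ w) (hs : 0 ≤ s) :
    volume (stripBall w s) = ENNReal.ofReal (2 * w * (w + 2 * s)) := by
  rw [← setLIntegral_one, setLIntegral_stripBall w s measurable_const]
  simp only [setLIntegral_one, Real.volume_Icc]
  have : ∀ x : ℝ, w + s - |x| - -(w + s - |x|) = (fun t => 2 * (w + s - t)) |x| := fun x => by
    simp only
    ring
  simp only [this]
  rw [lintegral_Icc_abs (f := fun t => 2 * (w + s - t)) (F := fun t => 2 * ((w + s) * t - t ^ 2 / 2))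
    hw (fun x => by
      have h := (((hasDerivAt_id x).const_mul (w + s)).sub
        (((hasDerivAt_id x).pow 2).div_const 2)).const_mul 2
      refine h.congr_deriv ?_
      simp) (by fun_prop) (fun x _ h => by linarith)]
  congr 1
  ring

theorem lintegral_l1_stripBall {w s : ℝ} (hw : 0 ≤ w) (hs : 0 ≤ s) :
    ∫⁻ p in stripBall w s, ENNReal.ofReal (|p.1| + |p.2|) =
      ENNReal.ofReal (2 * ((w + s) ^ 2 * w - w ^ 3 / 3)) := by
  rw [setLIntegral_stripBall w s (by fun_prop)]
  have hinner : ∀ x ∈ Set.Icc (-w) w, ∫⁻ y in Set.Icc (-(w + s - |x|)) (w + s - |x|),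
      ENNReal.ofReal (|x| + |y|) = ENNReal.ofReal ((fun t => (w + s) ^ 2 - t ^ 2) |x|) := by
    intro x hx
    have hx' := abs_le.2 hx
    rw [lintegral_Icc_abs (f := fun t => |x| + t) (F := fun t => |x| * t + t ^ 2 / 2)
      (by linarith) (fun t => by
        have h := ((hasDerivAt_id t).const_mul |x|).add (((hasDerivAt_id t).pow 2).div_const 2)
        refine h.congr_deriv ?_
        simp) (by fun_prop) (fun t ht _ => by positivity)]
    congr 1
    ring
  rw [setLIntegral_congr_fun measurableSet_Icc hinner,
    lintegral_Icc_abs (f := fun t => (w + s) ^ 2 - t ^ 2) (F := fun t => (w + s) ^ 2 * t - t ^ 3 / 3)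
    hw (fun x => by
      have h := ((hasDerivAt_id x).const_mul ((w + s) ^ 2)).sub
        (((hasDerivAt_id x).pow 3).div_const 3)
      refine h.congr_deriv ?_
      simp) (by fun_prop) (fun x h0 h => by nlinarith)]
  congr 1
  ring

theorem volume_stripBall_boundary (w s : ℝ) :
    volume {p : ℝ × ℝ | |p.1| = w ∨ |p.1| + |p.2| = w + s} = 0 := by
  have hfin : ∀ m : ℝ, volume {t : ℝ | |t| = m} = 0 := fun m => by
    refine measure_mono_null (t := {m, -m}) (fun t ht => ?_) (Set.Finite.measure_zero (by simp) _)
    exact eq_or_eq_neg_of_abs_eq ht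
  have hclosed : IsClosed {p : ℝ × ℝ | |p.1| = w ∨ |p.1| + |p.2| = w + s} :=
    (isClosed_eq (f := fun p : ℝ × ℝ => |p.1|) (by fun_prop) continuous_const).union
      (isClosed_eq (f := fun p : ℝ × ℝ => |p.1| + |p.2|) (by fun_prop) continuous_const)
  rw [Measure.volume_eq_prod, Measure.measure_prod_null hclosed.measurableSet]
  filter_upwards [measure_eq_zero_iff_ae_notMem.1 (hfin w)] with x hx
  refine measure_mono_null (fun y hy => ?_) (hfin (w + s - |x|))
  rcases hy with hy | hy
  · exact absurd hy hx
  · exact eq_sub_of_add_eq' hy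

/-! ### Translates of the tile as Voronoi cells and as a design. -/

theorem setLIntegral_translate (F : ℝ × ℝ → ENNReal) {A : Set (ℝ × ℝ)} (hA : MeasurableSet A)
    (c : ℝ × ℝ) : ∫⁻ p in {p | p - c ∈ A}, F (p - c) = ∫⁻ p in A, F p := by
  have hm : MeasurableSet {p | p - c ∈ A} := measurable_id.sub_const c hA
  rw [← lintegral_indicator hm, ← lintegral_indicator hA,
    ← lintegral_sub_right_eq_self (μ := (volume : Measure (ℝ × ℝ))) (A.indicator F) c]
  rfl

theorem volume_translate {A : Set (ℝ × ℝ)} (hA : MeasurableSet A) (c : ℝ × ℝ) :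
    volume {p | p - c ∈ A} = volume A := by
  rw [← setLIntegral_one, ← setLIntegral_one A]
  exact setLIntegral_translate (fun _ => 1) hA c

theorem tile_eq_l1VoronoiCell {w s : ℝ} (hw : 0 < w) (hs : 0 ≤ s) (i : ℕ) :
    {p | p - hexLattice w s (tour i) ∈ stripBall w s} =
      l1VoronoiCell (fun i => hexLattice w s (tour i)) i := by
  have hdist : ∀ (p : ℝ × ℝ) (v : ℤ × ℤ), l1Dist p (hexLattice w s (v + tour i)) =
      |(p - hexLattice w s (tour i)).1 - (hexLattice w s v).1| +
      |(p - hexLattice w s (tour i)).2 - (hexLattice w s v).2| := by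
    intro p v
    rw [← add_sub_cancel_right v (tour i), hexLattice_sub, add_sub_cancel_right]
    simp only [l1Dist, Prod.fst_sub, Prod.snd_sub]
    congr 2 <;> ring
  ext p
  constructor
  · intro hp j hj
    have hne : tour j - tour i ≠ 0 := sub_ne_zero.2 (tour_injective.ne hj)
    have h := l1_le_of_mem_stripBall hw.le hs hp hne
    rwa [← hdist, sub_add_cancel] at h
  · intro hp
    refine mem_stripBall_of_voronoi hw hs fun v hv => ?_
    obtain ⟨j, hj⟩ := tour_surjective (v + tour i)
    have hne : j ≠ i := by
      rintro rfl
      exact hv (by simpa using hj)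
    have h := hp j hne
    simp only [hj] at h
    rwa [hdist] at h

/-- The tiling of the plane by translates of an elongated hexagon, visited row by row. -/
noncomputable def hexDesign {w s : ℝ} (hw : 0 < w) (hs : 0 ≤ s) : FacilityDesign where
  site i := hexLattice w s (tour i)
  region i := {p | p - hexLattice w s (tour i) ∈ stripBall w s}
  measurableSet_region _ := measurable_id.sub_const _ (isClosed_stripBall w s).measurableSet
  area_lt_top i := by
    rw [volume_translate (isClosed_stripBall w s).measurableSet, volume_stripBall hw.le hs]
    exact ENNReal.ofReal_lt_top
  region_subset i := (tile_eq_l1VoronoiCell hw hs i).subset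
  iUnion_region := by
    refine Set.eq_univ_of_forall fun p => ?_
    obtain ⟨v, hv⟩ := exists_sub_hexLattice_mem hw hs p
    obtain ⟨i, rfl⟩ := tour_surjective v
    exact Set.mem_iUnion.2 ⟨i, hv⟩
  overlap_null i j hij := by
    have hclosed : MeasurableSet {p : ℝ × ℝ | |p.1| = w ∨ |p.1| + |p.2| = w + s} :=
      ((isClosed_eq (f := fun p : ℝ × ℝ => |p.1|) (by fun_prop) continuous_const).union
        (isClosed_eq (f := fun p : ℝ × ℝ => |p.1| + |p.2|) (by fun_prop)
          continuous_const)).measurableSet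
    have hnull := (volume_translate hclosed (hexLattice w s (tour i))).trans
      (volume_stripBall_boundary w s)
    refine measure_mono_null (fun p hp => ?_) hnull
    refine boundary_of_mem_two_tiles hw.le hs (v := tour j - tour i)
      (sub_ne_zero.2 (tour_injective.ne hij.symm)) hp.1 ?_
    rw [hexLattice_sub, sub_sub_sub_cancel_right]
    exact hp.2

/-! ### Cost of the hexagonal design. -/

theorem hexDesign_volume {w s : ℝ} (hw : 0 < w) (hs : 0 ≤ s) (i : ℕ) :
    volume ((hexDesign hw hs).region i) = ENNReal.ofReal (2 * w * (w + 2 * s)) :=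
  (volume_translate (isClosed_stripBall w s).measurableSet _).trans (volume_stripBall hw.le hs)

theorem hexDesign_outbound {w s : ℝ} (hw : 0 < w) (hs : 0 ≤ s) (i : ℕ) :
    (hexDesign hw hs).outbound i = ENNReal.ofReal (2 * ((w + s) ^ 2 * w - w ^ 3 / 3)) :=
  (setLIntegral_translate (fun p => ENNReal.ofReal (|p.1| + |p.2|))
    (isClosed_stripBall w s).measurableSet _).trans (lintegral_l1_stripBall hw.le hs)

theorem hexDesign_inbound_le {w s : ℝ} (hw : 0 < w) (hs : 0 ≤ s) (n : ℕ) :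
    ∑ i ∈ Finset.range (n + 1), (hexDesign hw hs).inboundLength (n + 1) i ≤
      2 * w * (n + 1) + 10 * (w + s) * ((tourLevel (tour n) : ℝ) + 1) ^ 2 := by
  -- A step costs `2 w` plus a multiple of the increase of `tourExcess`. The sum telescopes to at
  -- most `6 (w + s) (m + 1)²` at level `m`, and the return trip adds at most `4 (w + s) (m + 1)²`;
  -- hence the `10`.
  have hstep : ∀ i, l1Dist (hexLattice w s (tour i)) (hexLattice w s (tour (i + 1))) ≤
      2 * w + 2 * (w + s) * ((tourExcess (tour (i + 1)) : ℝ) - tourExcess (tour i)) := by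
    intro i
    rw [l1Dist_comm]
    refine (l1Dist_hexLattice_le hw.le hs _ _).trans ?_
    obtain ⟨h1, h2⟩ := tour_step i
    have h1' := (Int.cast_le (R := ℝ)).2 h1
    have h2' := (Int.cast_le (R := ℝ)).2 h2
    push_cast at h1' h2' ⊢
    nlinarith
  have hpath : ∑ i ∈ Finset.range n,
      l1Dist (hexLattice w s (tour i)) (hexLattice w s (tour (i + 1))) ≤
      2 * w * n + 2 * (w + s) * tourExcess (tour n) := by
    refine (Finset.sum_le_sum fun i _ => hstep i).trans (le_of_eq ?_)
    rw [Finset.sum_add_distrib, ← Finset.mul_sum (f := fun i => (tourExcess (tour (i + 1)) : ℝ) - tourExcess (tour i)),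
      Finset.sum_range_sub (fun i => (tourExcess (tour i) : ℝ)), tour_zero, tourExcess_zero]
    simp
    ring
  have hreturn := l1Dist_hexLattice_le hw.le hs (tour n) (tour 0)
  have hx := (Int.cast_le (R := ℝ)).2 (abs_fst_lt (tour n)).le
  have hy := (Int.cast_le (R := ℝ)).2 (abs_snd_le (tour n))
  have he := (Int.cast_le (R := ℝ)).2 (tourExcess_le (tour n))
  rw [FacilityDesign.sum_inboundLength]
  change ∑ i ∈ Finset.range n, l1Dist (hexLattice w s (tour i)) (hexLattice w s (tour (i + 1))) +
    l1Dist (hexLattice w s (tour n)) (hexLattice w s (tour 0)) ≤ _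
  rw [tour_zero] at *
  push_cast at *
  simp only [sub_zero] at hreturn
  have hm : (0 : ℝ) ≤ tourLevel (tour n) := Nat.cast_nonneg _
  generalize (tourLevel (tour n) : ℝ) = m at *
  have hm2 : m + 1 ≤ (m + 1) ^ 2 := by nlinarith
  have h1 := mul_le_mul_of_nonneg_left he (show 0 ≤ 2 * (w + s) by positivity)
  have h2 := mul_le_mul_of_nonneg_left (add_le_add hx (hy.trans hm2)) (show 0 ≤ 2 * w by positivity)
  have h3 := mul_le_mul_of_nonneg_left (hy.trans hm2) (show 0 ≤ 2 * s by positivity)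
  nlinarith

theorem hexDesign_avgCost_le {w s κ f r : ℝ} (hw : 0 < w) (hs : 0 ≤ s) (hκ : 0 < κ) (hf : 0 < f)
    (hr : 0 ≤ r) (n : ℕ) :
    (hexDesign hw hs).avgCost κ f r (n + 1) ≤
      ENNReal.ofReal (f / (2 * w * (w + 2 * s)) * (1 + κ * (2 * ((w + s) ^ 2 * w - w ^ 3 / 3))) +
        κ * r * f * (2 * w + 10 * (w + s) * (((tourLevel (tour n) : ℝ) + 1) ^ 2 / (n + 1)))) := by
  have hV : 0 < 2 * w * (w + 2 * s) := by positivity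
  have hO : 0 ≤ 2 * ((w + s) ^ 2 * w - w ^ 3 / 3) := by nlinarith [pow_pos hw 3, mul_nonneg hs hw.le]
  have hn : (0 : ℝ) < n + 1 := by positivity
  unfold FacilityDesign.avgCost
  simp only [hexDesign_volume, hexDesign_outbound, Finset.sum_const, Finset.card_range]
  rw [ENNReal.ofReal_add (by positivity) (by positivity)]
  refine add_le_add (le_of_eq ?_) (ENNReal.ofReal_le_ofReal ?_)
  · rw [← ENNReal.ofReal_mul hκ.le, ← ENNReal.ofReal_one, ← ENNReal.ofReal_add (by simp)
      (by positivity), nsmul_eq_mul, nsmul_eq_mul, ← ENNReal.ofReal_natCast,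
      ← ENNReal.ofReal_mul (by positivity), ← ENNReal.ofReal_mul (by positivity),
      ← ENNReal.ofReal_div_of_pos (by positivity), ← ENNReal.ofReal_mul (by positivity)]
    congr 1
    push_cast
    field_simp
  · have h := mul_le_mul_of_nonneg_left (hexDesign_inbound_le hw hs n)
      (show 0 ≤ κ * r * f / ((n + 1 : ℕ) : ℝ) by positivity)
    refine h.trans (le_of_eq ?_)
    push_cast
    field_simp

/-- Only an upper estimate of the tour length is needed: the lower half of the limit is the bound
valid for every design. -/
theorem tendsto_avgCost_hexDesign {w s κ f r : ℝ} (hw : 0 < w) (hs : 0 ≤ s) (hκ : 0 < κ)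
    (hf : 0 < f) (hr : 0 ≤ r)
    (hopt : f / (2 * w * (w + 2 * s)) * (1 + κ * (2 * ((w + s) ^ 2 * w - w ^ 3 / 3))) +
      κ * r * f * (2 * w) = optCost κ f r) :
    Tendsto ((hexDesign hw hs).avgCost κ f r) atTop (𝓝 (ENNReal.ofReal (optCost κ f r))) := by
  refine tendsto_of_le_liminf_of_limsup_le ((hexDesign hw hs).optCost_le_liminf hκ hf hr) ?_
  have hlim := ENNReal.tendsto_ofReal
    (((((tendsto_tourLevel_sq_div.const_mul (10 * (w + s))).const_add (2 * w)).const_mul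
      (κ * r * f)).const_add
      (f / (2 * w * (w + 2 * s)) * (1 + κ * (2 * ((w + s) ^ 2 * w - w ^ 3 / 3))))))
  rw [mul_zero, add_zero, hopt] at hlim
  rw [← limsup_nat_add _ 1, ← hlim.limsup_eq]
  exact limsup_le_limsup (Eventually.of_forall fun n => hexDesign_avgCost_le hw hs hκ hf hr n)

/-! ### The theorem. -/

theorem not_concyclic_hexVertices {R α : ℝ} (hc : 0 < R * Real.cos α) (hs : 0 < R * Real.sin α) :
    ¬ ∃ (c : ℝ × ℝ) (ρ : ℝ), ∀ v ∈ hexVertices R α,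
      (v.1 - c.1) ^ 2 + (v.2 - c.2) ^ 2 = ρ ^ 2 := by
  rintro ⟨c, ρ, h⟩
  unfold hexVertices at h
  generalize R * Real.cos α = w at *
  generalize R * Real.sin α = s at *
  have h1 := h (w, s) (by simp)
  have h2 := h (-w, -s) (by simp)
  have h3 := h (0, w + s) (by simp)
  have h4 := h (0, -(w + s)) (by simp)
  simp only at h1 h2 h3 h4
  -- Adding the equations of antipodal vertices cancels the terms linear in `c`; comparing the two
  -- sums gives `w² + s² = (w + s)²`, so `w s = 0`.
  nlinarith [mul_pos hc hs]

theorem mainTheorem7 (κ f r : ℝ) (hκ : 0 < κ) (hf : 0 < f) (hr : 0 ≤ r) :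
    IsLeast {z : ENNReal | ∃ D : FacilityDesign, Tendsto (D.avgCost κ f r) atTop (𝓝 z)}
        (ENNReal.ofReal (optCost κ f r)) ∧
      (∀ D : FacilityDesign,
        ENNReal.ofReal (optCost κ f r) ≤ liminf (D.avgCost κ f r) atTop) ∧
      (∃ (D : FacilityDesign) (R : ℝ), 0 < R ∧
        2 * R ^ 2 * (Real.cos (alphaStar r) ^ 2 + Real.sin (2 * alphaStar r)) =
          (κ / 2) ^ (-(2 / 3) : ℝ) * gBar r ^ (2 / 3 : ℝ) ∧
        (∀ i, D.region i = {p | p - D.site i ∈ elongatedHexagon R (alphaStar r)}) ∧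
        (∀ i, D.region i = l1VoronoiCell D.site i) ∧
        (0 < r → 0 < alphaStar r ∧ alphaStar r < Real.pi / 2 ∧
          ¬ ∃ (c : ℝ × ℝ) (ρ : ℝ), ∀ v ∈ hexVertices R (alphaStar r),
            (v.1 - c.1) ^ 2 + (v.2 - c.2) ^ 2 = ρ ^ 2) ∧
        Tendsto (D.avgCost κ f r) atTop (𝓝 (ENNReal.ofReal (optCost κ f r)))) := by
  have hC := travelConst_pos hr
  -- The equality case of AM-GM, `f / q² = f κ q C / 2` with `C = travelConst r`; the unit-area
  -- hexagon is scaled by `q`.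
  set q : ℝ := (2 / (κ * travelConst r)) ^ (1 / 3 : ℝ) with hq
  have hq0 : 0 < q := Real.rpow_pos_of_pos (by positivity) _
  have hq3 : q ^ 3 * (κ * travelConst r) = 2 := by
    rw [hq, ← Real.rpow_natCast, ← Real.rpow_mul (by positivity)]
    norm_num
    field_simp
  have hcos : q * unitRadius r * Real.cos (alphaStar r) = q * (√(1 / 2 + r) - √r) := by
    rw [mul_assoc, unitRadius_mul_cos]
  have hsin : q * unitRadius r * Real.sin (alphaStar r) = q * √r := by
    rw [mul_assoc, unitRadius_mul_sin hr]
  have hw : 0 < q * (√(1 / 2 + r) - √r) := mul_pos hq0 (sub_pos.2 (sqrt_lt_sqrt_half_add hr))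
  have hs : 0 ≤ q * √r := by positivity
  have harea := unit_area hr
  have hopt : optCost κ f r = 3 * f / q ^ 2 := by
    have h : κ ^ 2 * f ^ 3 / (4 * gBar r ^ 2) = (f / q ^ 2) ^ 3 := by
      rw [gBar_eq hr]
      field_simp
      linear_combination (q ^ 3 * (κ * travelConst r) + 2) * hq3
    rw [optCost, h, ← Real.rpow_natCast, ← Real.rpow_mul (by positivity)]
    norm_num
    ring
  have htend := tendsto_avgCost_hexDesign hw hs hκ hf hr (by
    rw [hopt]
    have hσ := Real.sq_sqrt hr
    have hV : 2 * (q * (√(1 / 2 + r) - √r)) * (q * (√(1 / 2 + r) - √r) + 2 * (q * √r)) = q ^ 2 := by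
      linear_combination 2 * q ^ 2 * harea
    rw [hV]
    unfold travelConst at hq3
    generalize √(1 / 2 + r) = c at *
    generalize √r = σ at *
    -- At the optimum, travel costs twice as much as set-up, so the total is `3 f / q²`.
    have key : κ * (2 * ((q * (c - σ) + q * σ) ^ 2 * (q * (c - σ)) - (q * (c - σ)) ^ 3 / 3)) +
        κ * r * (2 * (q * (c - σ))) * q ^ 2 = 2 := by
      linear_combination hq3 - 2 * κ * q ^ 3 * (c - σ) * hσ
    field_simp at key ⊢
    linear_combination 2 * key)
  have hleast : ∀ D : FacilityDesign,
      ENNReal.ofReal (optCost κ f r) ≤ liminf (D.avgCost κ f r) atTop :=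
    fun D => D.optCost_le_liminf hκ hf hr
  refine ⟨⟨⟨_, htend⟩, ?_⟩, hleast, hexDesign hw hs, q * unitRadius r,
    mul_pos hq0 (unitRadius_pos hr), ?_, ?_, tile_eq_l1VoronoiCell hw hs, ?_, htend⟩
  · rintro z ⟨D, hD⟩
    rw [← hD.liminf_eq]
    exact hleast D
  · have h1 : 2 * (q * unitRadius r) ^ 2 *
        (Real.cos (alphaStar r) ^ 2 + Real.sin (2 * alphaStar r)) = q ^ 2 := by
      rw [Real.sin_two_mul]
      calc _ = 2 * (q * unitRadius r * Real.cos (alphaStar r)) *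
            (q * unitRadius r * Real.cos (alphaStar r) +
              2 * (q * unitRadius r * Real.sin (alphaStar r))) := by ring
        _ = q ^ 2 := by
          rw [hcos, hsin]
          linear_combination 2 * q ^ 2 * harea
    rw [h1, gBar_eq hr, hq, ← Real.rpow_natCast, ← Real.rpow_mul (by positivity),
      Real.rpow_neg (by positivity), ← Real.inv_rpow (by positivity),
      ← Real.mul_rpow (by positivity) (by positivity)]
    congr 1
    · field_simp
    · norm_num
  · intro i
    rw [elongatedHexagon_eq_stripBall (by rw [hcos]; exact hw.le) (by rw [hsin]; exact hs), hcos,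
      hsin]
    rfl
  · intro hr0
    refine ⟨Real.arctan_pos.2 (by positivity), Real.arctan_lt_pi_div_two _,
      not_concyclic_hexVertices ?_ ?_⟩
    · rw [hcos]
      exact hw
    · rw [hsin]
      positivity
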